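/- Let $\sigma(z)_i=e^{z_i}/\sum_{j=1}^K e^{z_j}$ for $z\in\mathbb R^K$, and let $\ell(\hat y,y)=-\log(\sigma(\hat y)_y)$ be the logistic loss, for $\hat y\in\mathbb R^K$ and $y\in\{1,\dots,K\}$. For $x\in\mathbb R^{d'}$ let $\Phi(x)\in\mathbb R^{d'K\times K}$ be the matrix whose $j$-th column holds $x$ in the $j$-th block of $d'$ coordinates and zeros elsewhere, and for $\theta\in\mathbb R^{d'K}$ put $\ell_{x,y}(\theta)=\ell(\theta^\top\Phi(x),y)$. Given data $(x_1,y_1),\dots,(x_n,y_n)$, write $\ell_t=\ell_{x_t,y_t}$. A run of the Gaussian Aggregating Forecaster (GAF) with parameters $\lambda,\beta,\alpha>0$ consists of estimators $\theta_1,\dots,\theta_n\in\mathbb R^{d'K}$ and predictions $\hat y_1,\dots,\hat y_n\in\mathbb R^K$ such that $\theta_1=0$ and $$\theta_t\in\operatorname*{arg\,min}_{\theta\in\mathbb R^{d'K}}\Big\{\sum_{s=1}^{t-2}\tilde\ell_s(\theta)+\ell_{t-1}(\theta)+\lambda\|\theta\|_2^2\Big\}\qquad(2\le t\le n),$$ where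 $$\tilde\ell_{s}(\theta)=\ell_{s}(\theta_{s+1})+\nabla\ell_{s}(\theta_{s+1})^\top(\theta-\theta_{s+1})+\tfrac{\beta}{2}(\theta-\theta_{s+1})^\top\nabla^2\ell_{s}(\theta_{s+1})(\theta-\theta_{s+1}),$$ and, for every $1\le t\le n$ and every $y\in\{1,\dots,K\}$, $$\ell(\hat y_t,y)\le-\frac1\alpha\log\Big(\mathbb E_{\theta\sim\tilde P_{t-1}}e^{-\alpha\ell_{x_t,y}(\theta)}\Big),$$ where $\tilde P_{t-1}$ is the probability measure on $\mathbb R^{d'K}$ with Lebesgue density proportional to $\exp\big(-\alpha\big(\sum_{s=1}^{t-1}\tilde\ell_s(\theta)+\lambda\|\theta\|_2^2\big)\big)$. There are universal constants $C>0$ and $c\ge0$ such that the following holds for all integers $d',n,K\ge1$, all reals $R,B>0$ and every sequence $(x_1,y_1),\dots,(x_n,y_n)$ in $\mathbb R^{d'}\times\{1,\dots,K\}$ with $\|x_t\|_2\le R$ for all $t$. Put $\lambda=32d'KR^2$, $\beta=\big(\tfrac{\log K}{2}+BR+1\big)^{-1}$ and $\alpha=1$. Then a run of GAF with these parameters exists,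 and the predictions of every such run satisfy, for all $\theta\in\mathbb R^{d'K}$ with $\|\theta\|_2\le B$, $$\sum_{t=1}^n\ell(\hat y_t,y_t)-\sum_{t=1}^n\ell_{x_t,y_t}(\theta)\;\le\;C\Big(d'KB^2R^2+d'K(\log K+BR)\log\Big(1+\frac{n}{d'K(\log K+BR)}\Big)\Big)+c.$$ -/

import Mathlib

open MeasureTheory

noncomputable section

namespace GAF

/-! ### Online prediction and the Gaussian Aggregating Forecaster, for a general loss

Rounds are numbered from `1`; sequences are indexed by `ℕ` and only the indices of actual rounds
matter. The parameter space is `EuclideanSpace ℝ ι`, `𝓧`, `𝓨`, `P` are the spaces of inputs, of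
outcomes and of predictions, `ℓ : P → 𝓨 → ℝ` is the loss and `f θ : 𝓧 → P` the reference
predictor with parameter `θ`. -/

/-- The loss `ℓ_{x,y}(θ) = ℓ(f_θ(x), y)` as a function of the parameter `θ`. -/
def paramLoss {E 𝓧 𝓨 P : Type*} (ℓ : P → 𝓨 → ℝ) (f : E → 𝓧 → P) (x : 𝓧) (y : 𝓨) (θ : E) : ℝ :=
  ℓ (f θ x) y

/-- The regret
`R_n(θ) = ∑_{t=1}^n ℓ(ŷ_t, y_t) - ∑_{t=1}^n ℓ_{x_t,y_t}(θ)` of the predictions `ŷ`. -/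
def regret {E 𝓧 𝓨 P : Type*} (ℓ : P → 𝓨 → ℝ) (f : E → 𝓧 → P) (x : ℕ → 𝓧) (y : ℕ → 𝓨)
    (yhat : ℕ → P) (n : ℕ) (θ : E) : ℝ :=
  ∑ t ∈ Finset.Icc 1 n, ℓ (yhat t) (y t) - ∑ t ∈ Finset.Icc 1 n, paramLoss ℓ f (x t) (y t) θ

/-- The quadratic approximation of `g` at `a` with curvature parameter `β`:
`u ↦ g(a) + ∇g(a)ᵀ(u - a) + (β/2) (u - a)ᵀ ∇²g(a) (u - a)`. -/
def quadApprox {E : Type*} [NormedAddCommGroup E] [NormedSpace ℝ E]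
    (β : ℝ) (g : E → ℝ) (a u : E) : ℝ :=
  g a + fderiv ℝ g a (u - a) + β / 2 * fderiv ℝ (fderiv ℝ g) a (u - a) (u - a)

/-- The surrogate loss `ℓ̃_s`: the quadratic approximation of `ℓ_s = ℓ_{x_s,y_s}` at `θ_{s+1}`. -/
def surrogate {E 𝓧 𝓨 P : Type*} [NormedAddCommGroup E] [NormedSpace ℝ E]
    (ℓ : P → 𝓨 → ℝ) (f : E → 𝓧 → P) (β : ℝ) (x : ℕ → 𝓧) (y : ℕ → 𝓨) (θ : ℕ → E)
    (s : ℕ) (u : E) : ℝ :=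
  quadApprox β (paramLoss ℓ f (x s) (y s)) (θ (s + 1)) u

/-- The regularized cumulative surrogate loss
`L̃_t(u) = ∑_{s=1}^t ℓ̃_s(u) + lam ‖u‖²`. -/
def cumSurrogate {E 𝓧 𝓨 P : Type*} [NormedAddCommGroup E] [NormedSpace ℝ E]
    (ℓ : P → 𝓨 → ℝ) (f : E → 𝓧 → P) (lam β : ℝ) (x : ℕ → 𝓧) (y : ℕ → 𝓨) (θ : ℕ → E)
    (t : ℕ) (u : E) : ℝ :=
  ∑ s ∈ Finset.Icc 1 t, surrogate ℓ f β x y θ s u + lam * ‖u‖ ^ 2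

/-- The aggregating distribution `P̃_t`, with density
`exp(-α L̃_t(u)) / ∫ exp(-α L̃_t(v)) dv` with respect to Lebesgue measure. -/
def aggDist {ι 𝓧 𝓨 P : Type*} [Fintype ι]
    (ℓ : P → 𝓨 → ℝ) (f : EuclideanSpace ℝ ι → 𝓧 → P) (lam β α : ℝ) (x : ℕ → 𝓧) (y : ℕ → 𝓨)
    (θ : ℕ → EuclideanSpace ℝ ι) (t : ℕ) : Measure (EuclideanSpace ℝ ι) :=
  (volume : Measure (EuclideanSpace ℝ ι)).tilted
    (fun u => -α * cumSurrogate ℓ f lam β x y θ t u)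

/-- `θ` and `yhat` are the estimators and the predictions of a run of GAF, with parameters
`lam`, `β`, `α`, during the rounds `1, …, n` on the data `(x_t, y_t)`. -/
structure IsRun {ι 𝓧 𝓨 P : Type*} [Fintype ι]
    (ℓ : P → 𝓨 → ℝ) (f : EuclideanSpace ℝ ι → 𝓧 → P) (lam β α : ℝ) (n : ℕ)
    (x : ℕ → 𝓧) (y : ℕ → 𝓨) (θ : ℕ → EuclideanSpace ℝ ι) (yhat : ℕ → P) : Prop where
  /-- In the first round there is no past loss, and `θ_1` is the minimizer `0` of `lam ‖u‖²`. -/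
  init : θ 1 = 0
  /-- `θ_t` minimizes `∑_{s=1}^{t-2} ℓ̃_s(u) + ℓ_{t-1}(u) + lam ‖u‖²` over all `u`. -/
  estimator : ∀ t, 2 ≤ t → t ≤ n →
    IsMinOn (fun u => ∑ s ∈ Finset.Icc 1 (t - 2), surrogate ℓ f β x y θ s u
      + paramLoss ℓ f (x (t - 1)) (y (t - 1)) u + lam * ‖u‖ ^ 2) Set.univ (θ t)
  /-- `ŷ_t` satisfies the mixability inequality for `P̃_{t-1}`, for every possible outcome. -/
  prediction : ∀ t, 1 ≤ t → t ≤ n → ∀ y' : 𝓨,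
    ℓ (yhat t) y' ≤ -(1 / α) * Real.log
      (∫ u, Real.exp (-α * paramLoss ℓ f (x t) y' u) ∂(aggDist ℓ f lam β α x y θ (t - 1)))

/-! ### Multi-class logistic regression -/

/-- The softmax function `σ(z)_i = e^{z_i} / ∑_j e^{z_j}`. -/
def softmax {K : ℕ} (z : Fin K → ℝ) (i : Fin K) : ℝ :=
  Real.exp (z i) / ∑ j, Real.exp (z j)

/-- The logistic loss `ℓ(z, y) = -log(σ(z)_y)`. -/
def logisticLoss {K : ℕ} (z : Fin K → ℝ) (y : Fin K) : ℝ :=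
  -Real.log (softmax z y)

/-- The feature matrix `Φ(x)`, of size `d'K × K`: column `j` holds `x` in block `j` and zeros
elsewhere. The `d'K` rows are indexed by the pairs (block, position in the block). -/
def featureMap {d' K : ℕ} (x : EuclideanSpace ℝ (Fin d')) :
    Matrix (Fin K × Fin d') (Fin K) ℝ :=
  fun p j => if p.1 = j then x p.2 else 0

/-- The linear predictor `f_θ(x) = θᵀ Φ(x)`. -/
def linearPredictor {d' K : ℕ} (θ : EuclideanSpace ℝ (Fin K × Fin d'))
    (x : EuclideanSpace ℝ (Fin d')) : Fin K → ℝ :=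
  Matrix.vecMul (WithLp.ofLp θ) (featureMap x)

end GAF

end

noncomputable section

namespace GAF

/-! ### A quadratic lower bound for the logistic loss -/

/-! By mixability each loss of the forecaster is at most the mix loss `-log E exp(-ℓ_t)` under
`P̃_{t-1}`. With `ℓ̃_t` in place of `ℓ_t` the mix losses would telescope into log-partition
functions of `L̃`; the proof bounds the price of this replacement.

Let `Q`, `Q'` be the Hessians of `L̃_{t-1}`, `L̃_t`. As `θ_{t+1}` minimizes `L̃_{t-1} + ℓ_t`, and
`ℓ̃_t` agrees with `ℓ_t` there to first order, `L̃_t` is a pure quadratic around `θ_{t+1}`. There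
`ℓ_t` exceeds its linear part by at most an average `ρ` of `exp(X) - 1` over the centred scores `X`.
Jensen under the Gaussian of precision `Q'` costs the mean of `ρ`. The regularization keeps the
variances of the `X` at most 1, so this is at most the mean of the Hessian form of `ℓ_t`, and a
second Jensen bounds that by `(2/β) (log Z(Q) - log Z(Q'))`, which telescopes too
(`neg_log_integral_tilted_le`).

The final potential is explicit, since `L̃_n` is centred at its minimizer (`sum_mix_loss_sub_le`).
Its minimum is at most `L̃_n(u)`, hence at most `∑ ℓ_t(u) + lam ‖u‖²`, because `β` is small enough
for the surrogates to lie below the losses on the ball (`quadApprox_catLoss_le`). This rests on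
comparing a variance with a Kullback–Leibler divergence (`variance_le_bregman_logSumExp`). The total
decrease of `log Z` gives the logarithm. -/

lemma two_sub_le_mul_exp_neg {y : ℝ} (hy : 0 ≤ y) : 2 - y ≤ (2 + y) * Real.exp (-y) := by
  have hd : ∀ x : ℝ, HasDerivAt (fun x => (2 + x) * Real.exp (-x) + x)
      (1 - (1 + x) * Real.exp (-x)) x := by
    intro x
    have h1 : HasDerivAt (fun x : ℝ => 2 + x) 1 x := (hasDerivAt_id x).const_add 2
    have h2 : HasDerivAt (fun x : ℝ => Real.exp (-x)) (Real.exp (-x) * (-1)) x :=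
      ((hasDerivAt_id x).neg).exp
    refine ((h1.mul h2).add (hasDerivAt_id x)).congr_deriv ?_
    ring
  have hm : Monotone (fun x : ℝ => (2 + x) * Real.exp (-x) + x) := by
    refine monotone_of_deriv_nonneg (fun x => (hd x).differentiableAt) fun x => ?_
    rw [(hd x).deriv, sub_nonneg]
    calc (1 + x) * Real.exp (-x) ≤ Real.exp x * Real.exp (-x) := by
          gcongr
          linarith [Real.add_one_le_exp x]
      _ = 1 := by rw [← Real.exp_add]; simp
  have := hm hy
  simp only [add_zero, neg_zero, Real.exp_zero, mul_one] at this
  linarith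

/-- For `y ≥ 0` the factor `M + 2` may be lowered to `y + 2`, which is the previous lemma; for `y ≤
0` the factor 2 suffices. Applied to log-likelihood ratios, it bounds their second moment by a
divergence. -/
lemma sq_le_mul_exp_neg_sub {M y : ℝ} (hM : 0 ≤ M) (hy : y ≤ M) :
    y ^ 2 ≤ (M + 2) * (Real.exp (-y) - 1 + y) := by
  have h0 : 0 ≤ Real.exp (-y) - 1 + y := by linarith [Real.add_one_le_exp (-y)]
  rcases le_total 0 y with h | h
  · have h1 := two_sub_le_mul_exp_neg h
    have h2 : (y + 2) * (Real.exp (-y) - 1 + y) ≤ (M + 2) * (Real.exp (-y) - 1 + y) := by gcongr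
    nlinarith
  · have h1 := Real.quadratic_le_exp_of_nonneg (neg_nonneg.2 h)
    nlinarith

section Softmax

variable {K : ℕ}

lemma sum_exp_pos (z : Fin K → ℝ) (i : Fin K) : 0 < ∑ j, Real.exp (z j) :=
  Finset.sum_pos (fun _ _ => Real.exp_pos _) ⟨i, Finset.mem_univ i⟩

lemma softmax_pos (z : Fin K → ℝ) (i : Fin K) : 0 < softmax z i :=
  div_pos (Real.exp_pos _) (sum_exp_pos z i)

lemma sum_softmax [NeZero K] (z : Fin K → ℝ) : ∑ i, softmax z i = 1 := by
  simp only [softmax, ← Finset.sum_div]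
  exact div_self (sum_exp_pos z 0).ne'

lemma softmax_le_one [NeZero K] (z : Fin K → ℝ) (i : Fin K) : softmax z i ≤ 1 := by
  rw [← sum_softmax z]
  exact Finset.single_le_sum (fun j _ => (softmax_pos z j).le) (Finset.mem_univ i)

lemma logisticLoss_eq (z : Fin K → ℝ) (y : Fin K) :
    logisticLoss z y = Real.log (∑ j, Real.exp (z j)) - z y := by
  rw [logisticLoss, softmax, Real.log_div (Real.exp_pos _).ne' (sum_exp_pos z y).ne', Real.log_exp]
  ring

lemma exp_neg_logisticLoss (z : Fin K → ℝ) (y : Fin K) :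
    Real.exp (-logisticLoss z y) = softmax z y := by
  rw [logisticLoss, neg_neg, Real.exp_log (softmax_pos z y)]

lemma logisticLoss_nonneg [NeZero K] (z : Fin K → ℝ) (y : Fin K) : 0 ≤ logisticLoss z y := by
  rw [logisticLoss, neg_nonneg]
  exact Real.log_nonpos (softmax_pos z y).le (softmax_le_one z y)

/-- The Bregman divergence of the log-partition function dominates a variance. -/
lemma variance_le_bregman_logSumExp [NeZero K] {b : ℝ} (hb : 0 ≤ b) (z w : Fin K → ℝ)
    (hz : ∀ i, |z i| ≤ b) :
    ∑ j, softmax w j * (z j - w j - ∑ i, softmax w i * (z i - w i)) ^ 2 ≤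
      (Real.log K + 2 * b + 2) *
        (Real.log (∑ j, Real.exp (z j)) - Real.log (∑ j, Real.exp (w j))
          - ∑ j, softmax w j * (z j - w j)) := by
  have hZ := sum_exp_pos z 0
  have hW := sum_exp_pos w 0
  have hK : (0 : ℝ) < K := by exact_mod_cast Nat.pos_of_ne_zero (NeZero.ne K)
  have hK1 : (1 : ℝ) ≤ K := by exact_mod_cast Nat.one_le_iff_ne_zero.2 (NeZero.ne K)
  -- With `p`, `q` the softmax of `w`, `z`, the number `c - (z i - w i)` is `log (p_i / q_i)`. Its
  -- `p`-mean `c - m` is the divergence of `p` from `q`, and it is at most `-log q_i ≤ log K + 2b`,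
  -- so only `z` has to be bounded.
  set c := Real.log (∑ j, Real.exp (z j)) - Real.log (∑ j, Real.exp (w j)) with hc
  set m := ∑ i, softmax w i * (z i - w i) with hm
  have hsum := sum_softmax w
  have hM : ∀ i, c - (z i - w i) ≤ Real.log K + 2 * b := by
    intro i
    have h1 : Real.log (∑ j, Real.exp (z j)) ≤ Real.log K + b := by
      rw [← Real.log_exp b, ← Real.log_mul hK.ne' (Real.exp_pos _).ne']
      refine Real.log_le_log hZ ?_
      calc ∑ j, Real.exp (z j) ≤ ∑ _j : Fin K, Real.exp b :=
            Finset.sum_le_sum fun j _ => Real.exp_le_exp.2 ((le_abs_self _).trans (hz j))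
        _ = K * Real.exp b := by simp
    have h2 : w i ≤ Real.log (∑ j, Real.exp (w j)) := by
      rw [Real.le_log_iff_exp_le hW]
      exact Finset.single_le_sum (f := fun j => Real.exp (w j)) (fun j _ => (Real.exp_pos _).le)
        (Finset.mem_univ i)
    have h3 := (abs_le.1 (hz i)).1
    rw [hc]; linarith
  have hexp : ∑ i, softmax w i * Real.exp (-(c - (z i - w i))) = 1 := by
    have h : ∀ i, softmax w i * Real.exp (-(c - (z i - w i)))
        = Real.exp (z i) / ∑ j, Real.exp (z j) := by
      intro i
      have : -(c - (z i - w i)) = z i - w i + Real.log (∑ j, Real.exp (w j))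
          - Real.log (∑ j, Real.exp (z j)) := by rw [hc]; ring
      rw [this, Real.exp_sub, Real.exp_add, Real.exp_sub, Real.exp_log hZ, Real.exp_log hW, softmax]
      have := (Real.exp_pos (w i)).ne'
      field_simp
    rw [Finset.sum_congr rfl fun i _ => h i, ← Finset.sum_div, div_self hZ.ne']
  have hkey : ∑ i, softmax w i * (c - (z i - w i)) ^ 2 ≤ (Real.log K + 2 * b + 2) * (c - m) := by
    calc ∑ i, softmax w i * (c - (z i - w i)) ^ 2
        ≤ ∑ i, softmax w i * ((Real.log K + 2 * b + 2) *
            (Real.exp (-(c - (z i - w i))) - 1 + (c - (z i - w i)))) := by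
          refine Finset.sum_le_sum fun i _ => mul_le_mul_of_nonneg_left ?_ (softmax_pos w i).le
          exact sq_le_mul_exp_neg_sub (by linarith [Real.log_nonneg hK1]) (hM i)
      _ = (Real.log K + 2 * b + 2) * (∑ i, softmax w i * Real.exp (-(c - (z i - w i)))
            - ∑ i, softmax w i + c * (∑ i, softmax w i) - m) := by
          rw [hm, Finset.mul_sum (a := c), ← Finset.sum_sub_distrib, ← Finset.sum_add_distrib,
            ← Finset.sum_sub_distrib, Finset.mul_sum]
          refine Finset.sum_congr rfl fun i _ => by ring
      _ = _ := by rw [hexp, hsum]; ring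
  refine le_trans ?_ hkey
  -- The second moment is the variance plus the squared mean, which is then dropped.
  have hid : ∑ i, softmax w i * (c - (z i - w i)) ^ 2
      = ∑ i, softmax w i * (z i - w i - m) ^ 2 + (c - m) ^ 2 := by
    have e : ∀ i, softmax w i * (c - (z i - w i)) ^ 2 = softmax w i * (z i - w i - m) ^ 2
        + ((c ^ 2 - m ^ 2) * softmax w i - 2 * (c - m) * (softmax w i * (z i - w i))) := by
      intro i; ring
    rw [Finset.sum_congr rfl fun i _ => e i, Finset.sum_add_distrib, Finset.sum_sub_distrib,
      ← Finset.mul_sum, ← Finset.mul_sum, hsum, ← hm]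
    ring
  rw [hid]
  nlinarith [sq_nonneg (c - m)]

end Softmax

/-! ### The logistic loss of linear scores and its derivatives -/

section CatLoss

variable {K : ℕ} {E : Type*} [NormedAddCommGroup E] [NormedSpace ℝ E]

/-- The logistic loss of the linear scores `φ_j(θ)`. -/
def catLoss (φ : Fin K → E →L[ℝ] ℝ) (y : Fin K) (θ : E) : ℝ :=
  logisticLoss (fun j => φ j θ) y

/-- The class probabilities of the linear scores `φ_j(θ)`. -/
def gibbs (φ : Fin K → E →L[ℝ] ℝ) (θ : E) (j : Fin K) : ℝ :=
  softmax (fun i => φ i θ) j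

/-- The mean `∑_j p_j φ_j` of the scores under the class probabilities at `θ`. -/
def gibbsMean (φ : Fin K → E →L[ℝ] ℝ) (θ : E) : E →L[ℝ] ℝ :=
  ∑ j, gibbs φ θ j • φ j

lemma gibbsMean_apply (φ : Fin K → E →L[ℝ] ℝ) (θ v : E) :
    gibbsMean φ θ v = ∑ j, gibbs φ θ j * φ j v := by
  simp [gibbsMean]

lemma gibbs_pos (φ : Fin K → E →L[ℝ] ℝ) (θ : E) (j : Fin K) : 0 < gibbs φ θ j :=
  softmax_pos _ _

lemma sum_gibbs [NeZero K] (φ : Fin K → E →L[ℝ] ℝ) (θ : E) : ∑ j, gibbs φ θ j = 1 :=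
  sum_softmax _

lemma hasFDerivAt_sum_exp (φ : Fin K → E →L[ℝ] ℝ) (θ : E) :
    HasFDerivAt (fun u => ∑ j, Real.exp (φ j u)) (∑ j, Real.exp (φ j θ) • φ j) θ := by
  have := HasFDerivAt.fun_sum (u := Finset.univ) (fun j _ => ((φ j).hasFDerivAt (x := θ)).exp)
  exact this

lemma sum_exp_smul (φ : Fin K → E →L[ℝ] ℝ) (θ : E) :
    (∑ j, Real.exp (φ j θ))⁻¹ • ∑ j, Real.exp (φ j θ) • φ j = gibbsMean φ θ := by
  simp only [gibbsMean, gibbs, softmax, Finset.smul_sum, smul_smul, div_eq_inv_mul]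

lemma hasFDerivAt_catLoss (φ : Fin K → E →L[ℝ] ℝ) (y : Fin K) (θ : E) :
    HasFDerivAt (catLoss φ y) (gibbsMean φ θ - φ y) θ := by
  have h : catLoss φ y = fun u => Real.log (∑ j, Real.exp (φ j u)) - φ y u := by
    funext u; exact logisticLoss_eq _ _
  rw [h, ← sum_exp_smul]
  exact ((hasFDerivAt_sum_exp φ θ).log (sum_exp_pos _ y).ne').sub (φ y).hasFDerivAt

lemma fderiv_catLoss (φ : Fin K → E →L[ℝ] ℝ) (y : Fin K) :
    fderiv ℝ (catLoss φ y) = fun θ => gibbsMean φ θ - φ y :=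
  funext fun θ => (hasFDerivAt_catLoss φ y θ).fderiv

/-- The probability of class `j` is `exp(-loss_j)`, so the gradient of the loss already contains the
answer. -/
lemma hasFDerivAt_gibbs [NeZero K] (φ : Fin K → E →L[ℝ] ℝ) (j : Fin K) (θ : E) :
    HasFDerivAt (fun u => gibbs φ u j) (gibbs φ θ j • (φ j - gibbsMean φ θ)) θ := by
  have h : (fun u => gibbs φ u j) = fun u => Real.exp (-catLoss φ j u) := by
    funext u; exact (exp_neg_logisticLoss _ _).symm
  rw [h]
  have := (hasFDerivAt_catLoss φ j θ).neg.exp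
  rwa [show Real.exp ((-catLoss φ j) θ) = gibbs φ θ j from exp_neg_logisticLoss _ _,
    neg_sub] at this

lemma fderiv_fderiv_catLoss [NeZero K] (φ : Fin K → E →L[ℝ] ℝ) (y : Fin K) (θ v w : E) :
    fderiv ℝ (fderiv ℝ (catLoss φ y)) θ v w
      = ∑ j, gibbs φ θ j * ((φ j - gibbsMean φ θ) v * (φ j - gibbsMean φ θ) w) := by
  have h : HasFDerivAt (fun u => gibbsMean φ u - φ y)
      (∑ j, (gibbs φ θ j • (φ j - gibbsMean φ θ)).smulRight (φ j)) θ := by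
    refine HasFDerivAt.sub_const (φ y) ?_
    refine HasFDerivAt.fun_sum fun j _ => ?_
    exact (hasFDerivAt_gibbs φ j θ).smul_const (φ j)
  rw [fderiv_catLoss, h.fderiv]
  -- The centred scores have mean zero, so the second factor of the covariance may be centred for
  -- free.
  have h0 : ∑ j, gibbs φ θ j * (φ j - gibbsMean φ θ) v = 0 := by
    simp only [sub_apply, mul_sub, Finset.sum_sub_distrib, ← Finset.sum_mul,
      sum_gibbs, gibbsMean_apply]
    ring
  simp only [sum_apply, ContinuousLinearMap.smulRight_apply,
    smul_apply, smul_eq_mul]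
  have e : ∀ j, gibbs φ θ j * ((φ j - gibbsMean φ θ) v * (φ j - gibbsMean φ θ) w)
      = gibbs φ θ j * (φ j - gibbsMean φ θ) v * φ j w
        - gibbs φ θ j * (φ j - gibbsMean φ θ) v * gibbsMean φ θ w := by
    intro j; rw [sub_apply (φ j) (gibbsMean φ θ) w]; ring
  rw [Finset.sum_congr rfl fun j _ => e j, Finset.sum_sub_distrib, ← Finset.sum_mul, h0]
  simp

lemma fderiv_fderiv_catLoss_symm [NeZero K] (φ : Fin K → E →L[ℝ] ℝ) (y : Fin K) (θ v w : E) :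
    fderiv ℝ (fderiv ℝ (catLoss φ y)) θ v w = fderiv ℝ (fderiv ℝ (catLoss φ y)) θ w v := by
  simp only [fderiv_fderiv_catLoss, mul_comm]

lemma fderiv_fderiv_catLoss_self [NeZero K] (φ : Fin K → E →L[ℝ] ℝ) (y : Fin K) (θ v : E) :
    fderiv ℝ (fderiv ℝ (catLoss φ y)) θ v v
      = ∑ j, gibbs φ θ j * (φ j - gibbsMean φ θ) v ^ 2 := by
  simp only [fderiv_fderiv_catLoss, sq]

lemma fderiv_fderiv_catLoss_nonneg [NeZero K] (φ : Fin K → E →L[ℝ] ℝ) (y : Fin K) (θ v : E) :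
    0 ≤ fderiv ℝ (fderiv ℝ (catLoss φ y)) θ v v := by
  rw [fderiv_fderiv_catLoss_self]
  exact Finset.sum_nonneg fun j _ => mul_nonneg (gibbs_pos φ θ j).le (sq_nonneg _)

lemma fderiv_fderiv_catLoss_le [NeZero K] {φ : Fin K → E →L[ℝ] ℝ} {R : ℝ} (hR : ∀ j, ‖φ j‖ ≤ R)
    (y : Fin K) (θ v : E) :
    fderiv ℝ (fderiv ℝ (catLoss φ y)) θ v v ≤ R ^ 2 * ‖v‖ ^ 2 := by
  rw [fderiv_fderiv_catLoss_self]
  have hs := sum_gibbs φ θ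
  have e : ∑ j, gibbs φ θ j * (φ j - gibbsMean φ θ) v ^ 2
      = ∑ j, gibbs φ θ j * φ j v ^ 2 - gibbsMean φ θ v ^ 2 := by
    have e1 : ∀ j, gibbs φ θ j * (φ j - gibbsMean φ θ) v ^ 2 = gibbs φ θ j * φ j v ^ 2
        - (2 * gibbsMean φ θ v * (gibbs φ θ j * φ j v) - gibbsMean φ θ v ^ 2 * gibbs φ θ j) := by
      intro j; rw [sub_apply]; ring
    rw [Finset.sum_congr rfl fun j _ => e1 j, Finset.sum_sub_distrib, Finset.sum_sub_distrib,
      ← Finset.mul_sum, ← Finset.mul_sum, hs, ← gibbsMean_apply]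
    ring
  calc _ ≤ ∑ j, gibbs φ θ j * φ j v ^ 2 := by rw [e]; linarith [sq_nonneg (gibbsMean φ θ v)]
    _ ≤ ∑ j, gibbs φ θ j * (R ^ 2 * ‖v‖ ^ 2) := by
        refine Finset.sum_le_sum fun j _ => mul_le_mul_of_nonneg_left ?_ (gibbs_pos φ θ j).le
        rw [← mul_pow, ← sq_abs]
        have := (φ j).le_of_opNorm_le (hR j) v
        rw [Real.norm_eq_abs] at this
        gcongr
    _ = R ^ 2 * ‖v‖ ^ 2 := by rw [← Finset.sum_mul, hs, one_mul]

lemma norm_gibbsMean_le [NeZero K] {φ : Fin K → E →L[ℝ] ℝ} {R : ℝ} (hR : ∀ j, ‖φ j‖ ≤ R) (θ : E) :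
    ‖gibbsMean φ θ‖ ≤ R := by
  calc ‖gibbsMean φ θ‖ ≤ ∑ j, ‖gibbs φ θ j • φ j‖ := norm_sum_le _ _
    _ ≤ ∑ j, gibbs φ θ j * R := by
        refine Finset.sum_le_sum fun j _ => ?_
        rw [norm_smul, Real.norm_of_nonneg (gibbs_pos φ θ j).le]
        exact mul_le_mul_of_nonneg_left (hR j) (gibbs_pos φ θ j).le
    _ = R := by rw [← Finset.sum_mul, sum_gibbs, one_mul]

lemma continuous_catLoss (φ : Fin K → E →L[ℝ] ℝ) (y : Fin K) : Continuous (catLoss φ y) :=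
  continuous_iff_continuousAt.2 fun θ => (hasFDerivAt_catLoss φ y θ).continuousAt

lemma catLoss_nonneg [NeZero K] (φ : Fin K → E →L[ℝ] ℝ) (y : Fin K) (θ : E) : 0 ≤ catLoss φ y θ :=
  logisticLoss_nonneg _ _

/-- On the ball where the scores are at most `b`, the logistic loss lies above each of its
quadratic approximations with curvature parameter `(log K / 2 + b + 1)⁻¹`. -/
lemma quadApprox_catLoss_le [NeZero K] {b : ℝ} (hb : 0 ≤ b) (φ : Fin K → E →L[ℝ] ℝ) (y : Fin K)
    (a u : E) (hu : ∀ j, |φ j u| ≤ b) :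
    quadApprox (Real.log K / 2 + b + 1)⁻¹ (catLoss φ y) a u ≤ catLoss φ y u := by
  have h := variance_le_bregman_logSumExp hb (fun j => φ j u) (fun j => φ j a) hu
  have hK1 : (1 : ℝ) ≤ K := by exact_mod_cast Nat.one_le_iff_ne_zero.2 (NeZero.ne K)
  have hlog := Real.log_nonneg hK1
  have hm : gibbsMean φ a (u - a) = ∑ j, softmax (fun j => φ j a) j * (φ j u - φ j a) := by
    simp only [gibbsMean_apply, map_sub, gibbs, mul_sub, Finset.sum_sub_distrib]
  rw [quadApprox, fderiv_fderiv_catLoss_self, fderiv_catLoss, catLoss, catLoss, logisticLoss_eq,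
    logisticLoss_eq]
  simp only [sub_apply, hm]
  simp only [gibbs, map_sub]
  set V := ∑ j, softmax (fun j => φ j a) j *
    (φ j u - φ j a - ∑ i, softmax (fun j => φ j a) i * (φ i u - φ i a)) ^ 2
  have hpos : 0 < Real.log K / 2 + b + 1 := by linarith
  -- This fixes the choice of `β`: `β / 2` is the reciprocal of the constant in
  -- `variance_le_bregman_logSumExp`.
  have h2 : (Real.log K / 2 + b + 1)⁻¹ / 2 * V ≤ Real.log (∑ j, Real.exp (φ j u))
      - Real.log (∑ j, Real.exp (φ j a)) - ∑ j, softmax (fun j => φ j a) j * (φ j u - φ j a) := by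
    have : (Real.log K / 2 + b + 1)⁻¹ / 2 * V = V / (Real.log K + 2 * b + 2) := by
      field_simp
    rw [this, div_le_iff₀ (by linarith)]
    linarith
  linarith

/-- The excess of the logistic loss over its linear approximation, bounded by exponential
moments of the centred scores. -/
lemma catLoss_add_le [NeZero K] (φ : Fin K → E →L[ℝ] ℝ) (y : Fin K) (a v : E) :
    catLoss φ y (a + v) ≤ catLoss φ y a + fderiv ℝ (catLoss φ y) a v
      + ∑ j, gibbs φ a j * (Real.exp ((φ j - gibbsMean φ a) v) - 1) := by
  have hA := sum_exp_pos (fun j => φ j a) y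
  have hB := sum_exp_pos (fun j => φ j (a + v)) y
  set m := gibbsMean φ a v with hm
  -- The excess is exactly the log of the mean exponential of the centred scores; `log x ≤ x - 1`
  -- then makes it a combination of exponentials of linear forms, whose Gaussian means are explicit.
  have e : ∑ j, gibbs φ a j * (Real.exp ((φ j - gibbsMean φ a) v) - 1)
      = Real.exp (-m) * (∑ j, Real.exp (φ j (a + v))) / (∑ j, Real.exp (φ j a)) - 1 := by
    simp only [mul_sub, Finset.sum_sub_distrib, mul_one, sum_gibbs]
    congr 1
    rw [Finset.mul_sum, Finset.sum_div]
    refine Finset.sum_congr rfl fun j _ => ?_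
    rw [gibbs, softmax, sub_apply, ← hm, map_add, Real.exp_add, sub_eq_neg_add,
      Real.exp_add]
    ring
  have h1 := Real.log_le_sub_one_of_pos
    (show 0 < Real.exp (-m) * (∑ j, Real.exp (φ j (a + v))) / (∑ j, Real.exp (φ j a)) by positivity)
  rw [Real.log_div (by positivity) hA.ne', Real.log_mul (Real.exp_pos _).ne' hB.ne',
    Real.log_exp] at h1
  rw [e, fderiv_catLoss, catLoss, catLoss, logisticLoss_eq, logisticLoss_eq]
  simp only [sub_apply, ← hm, map_add] at *
  linarith

end CatLoss

/-! ### Gaussian integrals of coercive quadratic forms -/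

section Coercive

variable {E : Type*} [NormedAddCommGroup E] [InnerProductSpace ℝ E] {Q : E →L[ℝ] E →L[ℝ] ℝ} {c : ℝ}

/-- Lax–Milgram. The vector `b` plays the role of `Q⁻¹X`, and `X b` that of the variance of `X`
under the Gaussian of precision `Q`. -/
lemma exists_riesz [FiniteDimensional ℝ E] (hc : 0 < c) (hQ : ∀ v, c * ‖v‖ ^ 2 ≤ Q v v)
    (X : E →L[ℝ] ℝ) : ∃ b, Q b = X := by
  have hco : IsCoercive Q := ⟨c, hc, fun u => by have := hQ u; rw [mul_assoc, ← sq]; exact this⟩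
  refine ⟨hco.continuousLinearEquivOfBilin.symm ((InnerProductSpace.toDual ℝ E).symm X), ?_⟩
  ext w
  rw [← hco.continuousLinearEquivOfBilin_apply]
  simp

lemma complete_square (hs : ∀ v w, Q v w = Q w v) (X : E →L[ℝ] ℝ) {b : E} (hb : Q b = X)
    (v : E) : -(1 / 2) * Q v v + X v = -(1 / 2) * Q (v - b) (v - b) + X b / 2 := by
  have h1 : Q v b = X v := by rw [hs, hb]
  have h2 : Q b v = X v := by rw [hb]
  have h3 : Q b b = X b := by rw [hb]
  simp only [map_sub, sub_apply, h1, h2, h3]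
  ring

lemma apply_riesz_nonneg (hc : 0 < c) (hQ : ∀ v, c * ‖v‖ ^ 2 ≤ Q v v) {X : E →L[ℝ] ℝ} {b : E}
    (hb : Q b = X) : 0 ≤ X b := by
  rw [← hb]
  exact le_trans (by positivity) (hQ b)

lemma apply_riesz_le (hc : 0 < c) (hQ : ∀ v, c * ‖v‖ ^ 2 ≤ Q v v) {X : E →L[ℝ] ℝ} {b : E}
    (hb : Q b = X) : X b ≤ ‖X‖ ^ 2 / c := by
  have h1 : c * ‖b‖ ^ 2 ≤ X b := by rw [← hb]; exact hQ b
  have h2 : X b ≤ ‖X‖ * ‖b‖ := (le_abs_self _).trans (X.le_opNorm b)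
  rw [le_div_iff₀ hc]
  nlinarith [sq_nonneg (‖X‖ - c * ‖b‖), mul_le_mul_of_nonneg_left h2 hc.le]

end Coercive

section Gaussian

variable {E : Type*} [NormedAddCommGroup E] [InnerProductSpace ℝ E] [FiniteDimensional ℝ E]
  [MeasurableSpace E] [BorelSpace E]

/-- The partition function `∫ exp(-Q(v,v)/2) dv` of a quadratic form. -/
def gaussZ (Q : E →L[ℝ] E →L[ℝ] ℝ) : ℝ :=
  ∫ v : E, Real.exp (-(1 / 2) * Q v v)

/-- The centred Gaussian measure with density proportional to `exp(-Q(v,v)/2)`. -/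
def gaussMeasure (Q : E →L[ℝ] E →L[ℝ] ℝ) : Measure E :=
  (volume : Measure E).tilted (fun v => -(1 / 2) * Q v v)

variable {Q : E →L[ℝ] E →L[ℝ] ℝ} {c : ℝ}

lemma integrable_exp_neg_mul_sq_norm (hc : 0 < c) :
    Integrable (fun v : E => Real.exp (-c * ‖v‖ ^ 2)) := by
  -- A non-integrable function has integral 0 by convention, whereas the known value is positive.
  by_contra h
  have h1 := GaussianFourier.integral_rexp_neg_mul_sq_norm (V := E) hc
  rw [integral_undef h] at h1
  have : 0 < (Real.pi / c) ^ (Module.finrank ℝ E / 2 : ℝ) :=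
    Real.rpow_pos_of_pos (div_pos Real.pi_pos hc) _
  linarith

lemma integrable_gauss (hc : 0 < c) (hQ : ∀ v, c * ‖v‖ ^ 2 ≤ Q v v) :
    Integrable (fun v : E => Real.exp (-(1 / 2) * Q v v)) := by
  refine (integrable_exp_neg_mul_sq_norm (E := E) (half_pos hc)).mono'
    (by fun_prop) (Filter.Eventually.of_forall fun v => ?_)
  rw [Real.norm_of_nonneg (Real.exp_pos _).le, Real.exp_le_exp]
  linarith [hQ v]

lemma gaussZ_pos (hc : 0 < c) (hQ : ∀ v, c * ‖v‖ ^ 2 ≤ Q v v) : 0 < gaussZ Q :=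
  integral_exp_pos (integrable_gauss hc hQ)

lemma isProbabilityMeasure_gaussMeasure (hc : 0 < c) (hQ : ∀ v, c * ‖v‖ ^ 2 ≤ Q v v) :
    IsProbabilityMeasure (gaussMeasure Q) :=
  isProbabilityMeasure_tilted (integrable_gauss hc hQ)

lemma integrable_gauss_add_linear (hc : 0 < c) (hQ : ∀ v, c * ‖v‖ ^ 2 ≤ Q v v)
    (hs : ∀ v w, Q v w = Q w v) (X : E →L[ℝ] ℝ) :
    Integrable (fun v : E => Real.exp (-(1 / 2) * Q v v + X v)) := by
  obtain ⟨b, hb⟩ := exists_riesz hc hQ X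
  simp_rw [complete_square hs X hb, Real.exp_add]
  exact ((integrable_gauss hc hQ).comp_sub_right b).mul_const _

lemma integrable_exp_linear (hc : 0 < c) (hQ : ∀ v, c * ‖v‖ ^ 2 ≤ Q v v)
    (hs : ∀ v w, Q v w = Q w v) (X : E →L[ℝ] ℝ) :
    Integrable (fun v => Real.exp (X v)) (gaussMeasure Q) := by
  rw [gaussMeasure, integrable_tilted_iff (integrable_gauss hc hQ)]
  simpa only [smul_eq_mul, ← Real.exp_add] using integrable_gauss_add_linear hc hQ hs X

lemma integral_exp_linear (hc : 0 < c) (hQ : ∀ v, c * ‖v‖ ^ 2 ≤ Q v v)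
    (hs : ∀ v w, Q v w = Q w v) (X : E →L[ℝ] ℝ) {b : E} (hb : Q b = X) :
    ∫ v, Real.exp (X v) ∂(gaussMeasure Q) = Real.exp (X b / 2) := by
  have hZ := gaussZ_pos hc hQ
  rw [gaussMeasure, integral_exp_tilted]
  simp only [Pi.add_apply]
  simp_rw [complete_square hs X hb, Real.exp_add]
  rw [integral_mul_const, integral_sub_right_eq_self (fun v => Real.exp (-(1 / 2) * Q v v)) b]
  exact mul_div_cancel_left₀ _ hZ.ne'

lemma integrableExpSet_linear (hc : 0 < c) (hQ : ∀ v, c * ‖v‖ ^ 2 ≤ Q v v)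
    (hs : ∀ v w, Q v w = Q w v) (X : E →L[ℝ] ℝ) :
    ProbabilityTheory.integrableExpSet X (gaussMeasure Q) = Set.univ := by
  refine Set.eq_univ_of_forall fun t => ?_
  exact integrable_exp_linear hc hQ hs (t • X)

lemma integrable_linear_sq (hc : 0 < c) (hQ : ∀ v, c * ‖v‖ ^ 2 ≤ Q v v)
    (hs : ∀ v w, Q v w = Q w v) (X : E →L[ℝ] ℝ) :
    Integrable (fun v => X v ^ 2) (gaussMeasure Q) := by
  exact ProbabilityTheory.integrable_pow_of_mem_interior_integrableExpSet
    (by rw [integrableExpSet_linear hc hQ hs]; simp) 2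

/-- `X` has the moment generating function of a centred real Gaussian of variance `X b`; the second
derivatives at 0 agree. -/
lemma integral_linear_sq (hc : 0 < c) (hQ : ∀ v, c * ‖v‖ ^ 2 ≤ Q v v)
    (hs : ∀ v w, Q v w = Q w v) (X : E →L[ℝ] ℝ) {b : E} (hb : Q b = X) :
    ∫ v, X v ^ 2 ∂(gaussMeasure Q) = X b := by
  set s : NNReal := ⟨X b, apply_riesz_nonneg hc hQ hb⟩ with hs'
  have hm : ProbabilityTheory.mgf X (gaussMeasure Q)
      = ProbabilityTheory.mgf id (ProbabilityTheory.gaussianReal 0 s) := by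
    rw [ProbabilityTheory.mgf_id_gaussianReal]
    funext t
    have h1 := integral_exp_linear hc hQ hs (t • X) (b := t • b) (by rw [map_smul, hb])
    simp only [smul_apply, smul_eq_mul, map_smul] at h1
    rw [ProbabilityTheory.mgf, h1]
    congr 1
    change t * (t * X b) / 2 = 0 * t + X b * t ^ 2 / 2
    ring
  have h1 := ProbabilityTheory.iteratedDeriv_mgf_zero (X := X) (μ := gaussMeasure Q)
    (by rw [integrableExpSet_linear hc hQ hs]; simp) 2
  have h2 := ProbabilityTheory.iteratedDeriv_mgf_zero (X := id)
    (μ := ProbabilityTheory.gaussianReal 0 s) (by simp) 2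
  have h3 := ProbabilityTheory.variance_id_gaussianReal (μ := 0) (v := s)
  rw [ProbabilityTheory.variance_of_integral_eq_zero (by fun_prop)
    (by simp [ProbabilityTheory.integral_id_gaussianReal])] at h3
  rw [hm, h2] at h1
  simp only [Pi.pow_apply] at h1 h3
  rw [← h1]
  exact h3

/-- The variance `s` of `X` is at most `‖X‖² / c ≤ 1`, and `exp(s/2) - 1 ≤ s` in that range. This is
where strong regularization is needed. -/
lemma integral_exp_linear_sub_one_le (hc : 0 < c) (hQ : ∀ v, c * ‖v‖ ^ 2 ≤ Q v v)
    (hs : ∀ v w, Q v w = Q w v) (X : E →L[ℝ] ℝ) (hX : ‖X‖ ^ 2 ≤ c) :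
    ∫ v, (Real.exp (X v) - 1) ∂(gaussMeasure Q) ≤ ∫ v, X v ^ 2 ∂(gaussMeasure Q) := by
  obtain ⟨b, hb⟩ := exists_riesz hc hQ X
  have := isProbabilityMeasure_gaussMeasure hc hQ
  rw [integral_linear_sq hc hQ hs X hb, integral_sub (integrable_exp_linear hc hQ hs X)
    (integrable_const _), integral_exp_linear hc hQ hs X hb]
  have h0 := apply_riesz_nonneg hc hQ hb
  have h1 : X b ≤ 1 := (apply_riesz_le hc hQ hb).trans ((div_le_one hc).2 hX)
  have h2 := Real.abs_exp_sub_one_le (x := X b / 2) (by rw [abs_of_nonneg (by linarith)]; linarith)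
  rw [abs_of_nonneg (by linarith : 0 ≤ X b / 2)] at h2
  have h3 := (le_abs_self _).trans h2
  simp
  linarith

lemma exp_integral_le {Ω : Type*} [MeasurableSpace Ω] {μ : Measure Ω} [IsProbabilityMeasure μ]
    {f : Ω → ℝ} (hf : Integrable f μ) (hf' : Integrable (fun x => Real.exp (f x)) μ) :
    Real.exp (∫ x, f x ∂μ) ≤ ∫ x, Real.exp (f x) ∂μ :=
  convexOn_exp.map_integral_le Real.continuous_exp.continuousOn isClosed_univ
    (by simp) hf hf'

/-- Adding a nonnegative form `H` to `Q` decreases the log-partition function by at least half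
the mean of `H` under the new Gaussian measure. -/
lemma half_integral_le_log_gaussZ_sub {Q' H : E →L[ℝ] E →L[ℝ] ℝ} (hc : 0 < c)
    (hQ : ∀ v, c * ‖v‖ ^ 2 ≤ Q v v) (hQ' : ∀ v, c * ‖v‖ ^ 2 ≤ Q' v v)
    (hH : ∀ v, Q' v v = Q v v + H v v) (hi : Integrable (fun v => H v v) (gaussMeasure Q')) :
    (∫ v, H v v ∂(gaussMeasure Q')) / 2 ≤ Real.log (gaussZ Q) - Real.log (gaussZ Q') := by
  have := isProbabilityMeasure_gaussMeasure hc hQ'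
  have hZ := gaussZ_pos hc hQ
  have hZ' := gaussZ_pos hc hQ'
  have e : ∀ v, -(1 / 2) * Q' v v + H v v / 2 = -(1 / 2) * Q v v := by
    intro v; rw [hH]; ring
  -- The ratio of partition functions is an exponential moment of `H`, to which Jensen applies.
  have h1 : ∫ v, Real.exp (H v v / 2) ∂(gaussMeasure Q') = gaussZ Q / gaussZ Q' := by
    rw [gaussMeasure, integral_exp_tilted]
    simp only [Pi.add_apply, e]
    rfl
  have h2 : Integrable (fun v => Real.exp (H v v / 2)) (gaussMeasure Q') := by
    rw [gaussMeasure, integrable_tilted_iff (integrable_gauss hc hQ')]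
    simp only [smul_eq_mul, ← Real.exp_add, e]
    exact integrable_gauss hc hQ
  have h3 := exp_integral_le (hi.div_const 2) h2
  rw [h1, integral_div, ← Real.le_log_iff_exp_le (div_pos hZ hZ'),
    Real.log_div hZ.ne' hZ'.ne'] at h3
  exact h3

/-- Comparison of the partition functions of `c‖·‖²` and of a form bounded by `C‖·‖²`. -/
lemma log_gaussZ_sub_le {Q' : E →L[ℝ] E →L[ℝ] ℝ} {C : ℝ} (hc : 0 < c)
    (hQ : ∀ v, Q v v = c * ‖v‖ ^ 2) (hQ' : ∀ v, c * ‖v‖ ^ 2 ≤ Q' v v)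
    (hC : ∀ v, Q' v v ≤ C * ‖v‖ ^ 2) (hcC : c ≤ C) :
    Real.log (gaussZ Q) - Real.log (gaussZ Q') ≤ Module.finrank ℝ E / 2 * Real.log (C / c) := by
  have hC0 : 0 < C := hc.trans_le hcC
  have h1 : gaussZ Q = (Real.pi / (c / 2)) ^ (Module.finrank ℝ E / 2 : ℝ) := by
    rw [← GaussianFourier.integral_rexp_neg_mul_sq_norm (V := E) (half_pos hc), gaussZ]
    congr 1; funext v; rw [hQ]; congr 1; ring
  have h2 : (Real.pi / (C / 2)) ^ (Module.finrank ℝ E / 2 : ℝ) ≤ gaussZ Q' := by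
    rw [← GaussianFourier.integral_rexp_neg_mul_sq_norm (V := E) (half_pos hC0), gaussZ]
    refine integral_mono (integrable_exp_neg_mul_sq_norm (half_pos hC0)) (integrable_gauss hc hQ')
      fun v => Real.exp_le_exp.2 ?_
    linarith [hC v]
  have h3 := Real.log_le_log (by have := Real.pi_pos; positivity) h2
  rw [Real.log_rpow (by have := Real.pi_pos; positivity)] at h3
  rw [h1, Real.log_rpow (by have := Real.pi_pos; positivity)]
  have h4 : Real.log (C / c) = Real.log (Real.pi / (c / 2)) - Real.log (Real.pi / (C / 2)) := by
    rw [← Real.log_div (by have := Real.pi_pos; positivity) (by have := Real.pi_pos; positivity)]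
    congr 1
    have := Real.pi_pos.ne'
    field_simp
  rw [h4, mul_sub]
  linarith

end Gaussian

/-! ### Quadratic functions -/

section Quadratic

variable {E : Type*} [NormedAddCommGroup E] [NormedSpace ℝ E]

/-- `L` is a quadratic function with Hessian `Q`. -/
def IsQuadratic (L : E → ℝ) (Q : E →L[ℝ] E →L[ℝ] ℝ) : Prop :=
  ∀ a, ∃ G : E →L[ℝ] ℝ, ∀ u, L u = L a + G (u - a) + 1 / 2 * Q (u - a) (u - a)

lemma IsQuadratic.add {L L' : E → ℝ} {Q Q' : E →L[ℝ] E →L[ℝ] ℝ} (h : IsQuadratic L Q)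
    (h' : IsQuadratic L' Q') : IsQuadratic (fun u => L u + L' u) (Q + Q') := by
  intro a
  obtain ⟨G, hG⟩ := h a
  obtain ⟨G', hG'⟩ := h' a
  refine ⟨G + G', fun u => ?_⟩
  simp only [add_apply]
  rw [hG u, hG' u]
  ring

lemma isQuadratic_quadApprox (β : ℝ) (g : E → ℝ) (a : E)
    (hs : ∀ v w, fderiv ℝ (fderiv ℝ g) a v w = fderiv ℝ (fderiv ℝ g) a w v) :
    IsQuadratic (quadApprox β g a) (β • fderiv ℝ (fderiv ℝ g) a) := by
  intro b
  refine ⟨fderiv ℝ g a + β • fderiv ℝ (fderiv ℝ g) a (b - a), fun u => ?_⟩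
  have e : u - a = (u - b) + (b - a) := by abel
  simp only [quadApprox, e, map_add, add_apply, smul_apply, smul_eq_mul, hs (u - b) (b - a)]
  ring

/-- The inner product as a continuous bilinear form. -/
def innerForm (E : Type*) [NormedAddCommGroup E] [InnerProductSpace ℝ E] : E →L[ℝ] E →L[ℝ] ℝ :=
  innerSL ℝ

lemma innerForm_apply {E : Type*} [NormedAddCommGroup E] [InnerProductSpace ℝ E] (v w : E) :
    innerForm E v w = inner ℝ v w := rfl

lemma isQuadratic_mul_sq_norm {E : Type*} [NormedAddCommGroup E] [InnerProductSpace ℝ E] (c : ℝ) :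
    IsQuadratic (fun u : E => c * ‖u‖ ^ 2) ((2 * c) • innerForm E) := by
  intro a
  refine ⟨(2 * c) • innerSL ℝ a, fun u => ?_⟩
  have e : u = a + (u - a) := by abel
  change c * ‖u‖ ^ 2 = c * ‖a‖ ^ 2 + 2 * c * inner ℝ a (u - a)
    + 1 / 2 * (2 * c * inner ℝ (u - a) (u - a))
  nth_rewrite 1 [e]
  rw [norm_add_sq_real, real_inner_self_eq_norm_sq]
  ring

lemma IsQuadratic.continuous {L : E → ℝ} {Q : E →L[ℝ] E →L[ℝ] ℝ} (h : IsQuadratic L Q) :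
    Continuous L := by
  obtain ⟨G, hG⟩ := h 0
  rw [funext hG]
  fun_prop

/-- Adding to a quadratic function the quadratic approximation of `g` at a minimizer `a` of the sum
with `g` yields a quadratic function whose linear term at `a` vanishes. -/
lemma IsQuadratic.add_quadApprox_eq {L g : E → ℝ} {Q : E →L[ℝ] E →L[ℝ] ℝ} (h : IsQuadratic L Q)
    {a : E} (hg : DifferentiableAt ℝ g a) (hmin : ∀ u, L a + g a ≤ L u + g u) (β : ℝ) (v : E) :
    L (a + v) + quadApprox β g a (a + v)
      = L a + g a + 1 / 2 * (Q + β • fderiv ℝ (fderiv ℝ g) a) v v := by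
  obtain ⟨G, hG⟩ := h a
  have hL : HasFDerivAt L G a := by
    have h1 : HasFDerivAt (fun u : E => u - a) (ContinuousLinearMap.id ℝ E) a :=
      (hasFDerivAt_id a).sub_const a
    have h2 := Q.hasFDerivAt_of_bilinear h1 h1
    have h3 := ((hasFDerivAt_const (L a) a).add (G.hasFDerivAt.comp a h1)).add
      (h2.const_mul (1 / 2))
    refine (h3.congr_of_eventuallyEq (Filter.Eventually.of_forall hG)).congr_fderiv ?_
    ext w
    simp
  have hz : G + fderiv ℝ g a = 0 := by
    have : IsLocalMin (fun u => L u + g u) a := Filter.Eventually.of_forall hmin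
    exact this.hasFDerivAt_eq_zero (hL.add hg.hasFDerivAt)
  have hv : G v + fderiv ℝ g a v = 0 := by
    rw [← add_apply, hz, zero_apply]
  rw [hG (a + v), quadApprox, add_sub_cancel_left]
  simp only [add_apply, smul_apply, smul_eq_mul]
  linear_combination hv

/-- The sum of a coercive quadratic function and of a nonnegative continuous function has
a minimizer. -/
lemma IsQuadratic.exists_isMinOn_add [FiniteDimensional ℝ E] {L g : E → ℝ}
    {Q : E →L[ℝ] E →L[ℝ] ℝ} {c : ℝ} (h : IsQuadratic L Q) (hc : 0 < c)
    (hQ : ∀ v, c * ‖v‖ ^ 2 ≤ Q v v) (hg : Continuous g) (hg0 : ∀ u, 0 ≤ g u) :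
    ∃ a, ∀ u, L a + g a ≤ L u + g u := by
  have : ProperSpace E := FiniteDimensional.proper ℝ E
  refine (h.continuous.add hg).exists_forall_le ?_
  obtain ⟨G, hG⟩ := h 0
  have hbound : ∀ u, L 0 + ‖u‖ * (c / 2 * ‖u‖ - ‖G‖) ≤ L u + g u := by
    intro u
    have h1 := hG u
    rw [sub_zero] at h1
    have h2 : -(‖G‖ * ‖u‖) ≤ G u := (abs_le.1 (G.le_opNorm u)).1
    have h3 := hQ u
    have h4 := hg0 u
    linarith
  refine Filter.tendsto_atTop_mono hbound ?_
  have hn := tendsto_norm_cocompact_atTop (E := E)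
  refine Filter.tendsto_atTop_add_const_left _ _ (hn.atTop_mul_atTop₀ ?_)
  simp only [sub_eq_add_neg]
  exact Filter.tendsto_atTop_add_const_right _ _ (hn.const_mul_atTop (half_pos hc))

end Quadratic

/-! ### The loss of one round -/

section Round

variable {E : Type*} [NormedAddCommGroup E] [InnerProductSpace ℝ E] [FiniteDimensional ℝ E]
  [MeasurableSpace E] [BorelSpace E] {L : E → ℝ} {Q : E →L[ℝ] E →L[ℝ] ℝ} {c : ℝ}

lemma IsQuadratic.integrable_exp_neg (h : IsQuadratic L Q) (hc : 0 < c)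
    (hQ : ∀ v, c * ‖v‖ ^ 2 ≤ Q v v) (hs : ∀ v w, Q v w = Q w v) :
    Integrable (fun u => Real.exp (-L u)) := by
  obtain ⟨G, hG⟩ := h 0
  have e : ∀ u, Real.exp (-L u) = Real.exp (-L 0) * Real.exp (-(1 / 2) * Q u u + (-G) u) := by
    intro u
    rw [hG u, sub_zero, ← Real.exp_add, neg_apply]
    congr 1; ring
  rw [funext e]
  exact (integrable_gauss_add_linear hc hQ hs (-G)).const_mul _

lemma integral_exp_neg_of_eq {a : E} (h : ∀ v, L (a + v) = L a + 1 / 2 * Q v v) :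
    ∫ u, Real.exp (-L u) = Real.exp (-L a) * gaussZ Q := by
  rw [← integral_add_left_eq_self _ a, gaussZ, ← integral_const_mul]
  congr 1; funext v
  rw [h, ← Real.exp_add]
  congr 1; ring

/-- The expected excess of the loss over its linear approximation is at most the expected
Hessian form. -/
lemma integral_gibbs_exp_sub_one_le {K : ℕ} [NeZero K] (hc : 0 < c)
    (hQ : ∀ v, c * ‖v‖ ^ 2 ≤ Q v v) (hs : ∀ v w, Q v w = Q w v) {φ : Fin K → E →L[ℝ] ℝ} {R : ℝ}
    (hR : ∀ j, ‖φ j‖ ≤ R) (hRc : 4 * R ^ 2 ≤ c) (y : Fin K) (a : E) :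
    ∫ v, ∑ j, gibbs φ a j * (Real.exp ((φ j - gibbsMean φ a) v) - 1) ∂(gaussMeasure Q)
      ≤ ∫ v, fderiv ℝ (fderiv ℝ (catLoss φ y)) a v v ∂(gaussMeasure Q) := by
  have := isProbabilityMeasure_gaussMeasure hc hQ
  simp only [fderiv_fderiv_catLoss_self]
  have h1 : ∀ j ∈ Finset.univ, Integrable
      (fun v => gibbs φ a j * (Real.exp ((φ j - gibbsMean φ a) v) - 1)) (gaussMeasure Q) :=
    fun j _ => ((integrable_exp_linear hc hQ hs _).sub (integrable_const 1)).const_mul _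
  rw [integral_finsetSum _ h1,
    integral_finsetSum _ fun j _ => (integrable_linear_sq hc hQ hs
      (φ j - gibbsMean φ a)).const_mul (gibbs φ a j)]
  refine Finset.sum_le_sum fun j _ => ?_
  rw [integral_const_mul, integral_const_mul]
  refine mul_le_mul_of_nonneg_left ?_ (gibbs_pos φ a j).le
  refine integral_exp_linear_sub_one_le hc hQ hs _ (le_trans ?_ hRc)
  have h1 : ‖φ j - gibbsMean φ a‖ ≤ 2 * R :=
    (norm_sub_le _ _).trans (by linarith [hR j, norm_gibbsMean_le hR a])
  calc ‖φ j - gibbsMean φ a‖ ^ 2 ≤ (2 * R) ^ 2 := by gcongr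
    _ = 4 * R ^ 2 := by ring

/-- The mix loss of a round is at most the increase of the potential. -/
lemma neg_log_integral_tilted_le {K : ℕ} [NeZero K] (h : IsQuadratic L Q) (hc : 0 < c)
    (hQ : ∀ v, c * ‖v‖ ^ 2 ≤ Q v v) (hs : ∀ v w, Q v w = Q w v) {φ : Fin K → E →L[ℝ] ℝ} {R : ℝ}
    (hR : ∀ j, ‖φ j‖ ≤ R) (hRc : 4 * R ^ 2 ≤ c) (y : Fin K) {β : ℝ} (hβ : 0 < β) {a : E}
    (hmin : ∀ u, L a + catLoss φ y a ≤ L u + catLoss φ y u) :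
    -Real.log (∫ u, Real.exp (-catLoss φ y u) ∂((volume : Measure E).tilted fun u => -L u)) ≤
      Real.log (∫ u, Real.exp (-L u))
        - Real.log (∫ u, Real.exp (-(L u + quadApprox β (catLoss φ y) a u)))
        + 2 / β * (Real.log (gaussZ Q)
          - Real.log (gaussZ (Q + β • fderiv ℝ (fderiv ℝ (catLoss φ y)) a))) := by
  set g := catLoss φ y with hg
  set H := fderiv ℝ (fderiv ℝ g) a with hH
  set Q' := Q + β • H with hQ'def
  have hHn : ∀ v, 0 ≤ H v v := fderiv_fderiv_catLoss_nonneg φ y a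
  have hQ' : ∀ v, c * ‖v‖ ^ 2 ≤ Q' v v := fun v =>
    (hQ v).trans (by simpa [hQ'def] using mul_nonneg hβ.le (hHn v))
  have hs' : ∀ v w, Q' v w = Q' w v := fun v w => by
    simp only [hQ'def, add_apply, smul_apply, hs v w, hH, hg, fderiv_fderiv_catLoss_symm φ y a v w]
  have hprob := isProbabilityMeasure_gaussMeasure hc hQ'
  have hZ' := gaussZ_pos hc hQ'
  set ρ : E → ℝ := fun v => ∑ j, gibbs φ a j * (Real.exp ((φ j - gibbsMean φ a) v) - 1) with hρ
  have hρi : Integrable ρ (gaussMeasure Q') :=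
    integrable_finsetSum _ fun j _ => ((integrable_exp_linear hc hQ' hs'
      (φ j - gibbsMean φ a)).sub (integrable_const 1)).const_mul (gibbs φ a j)
  have hHi : Integrable (fun v => H v v) (gaussMeasure Q') := by
    simp only [hH, hg, fderiv_fderiv_catLoss_self]
    exact integrable_finsetSum _ fun j _ => (integrable_linear_sq hc hQ' hs'
      (φ j - gibbsMean φ a)).const_mul (gibbs φ a j)
  have hdiff : DifferentiableAt ℝ g a := (hasFDerivAt_catLoss φ y a).differentiableAt
  have hquad := h.add_quadApprox_eq hdiff hmin β
  have hLi := h.integrable_exp_neg hc hQ hs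
  have hgi : Integrable (fun u => Real.exp (-(L u + g u))) := by
    refine hLi.mono' ((h.continuous.add (continuous_catLoss φ y)).neg.rexp.aestronglyMeasurable)
      (Filter.Eventually.of_forall fun u => ?_)
    rw [Real.norm_of_nonneg (Real.exp_pos _).le, Real.exp_le_exp]
    linarith [catLoss_nonneg φ y u]
  -- the new partition function
  have hnew : ∫ u, Real.exp (-(L u + quadApprox β g a u))
      = Real.exp (-(L a + g a)) * gaussZ Q' := by
    have h0 : L a + quadApprox β g a a = L a + g a := by simp [quadApprox]
    rw [← h0]
    refine integral_exp_neg_of_eq (L := fun u => L u + quadApprox β g a u) (a := a) fun v => ?_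
    rw [hquad v, h0]
  -- the expected excess is bounded by the decrease of the Gaussian log-partition function
  have hm1 : ∫ v, ρ v ∂(gaussMeasure Q') ≤ ∫ v, H v v ∂(gaussMeasure Q') :=
    integral_gibbs_exp_sub_one_le hc hQ' hs' hR hRc y a
  -- The comparison is made for `β • H`, whence the factor `2 / β` below.
  have hm2 : β / 2 * ∫ v, H v v ∂(gaussMeasure Q')
      ≤ Real.log (gaussZ Q) - Real.log (gaussZ Q') := by
    have := half_integral_le_log_gaussZ_sub (H := β • H) hc hQ hQ'
      (fun v => by simp [hQ'def]) (by simpa using hHi.const_mul β)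
    simp only [smul_apply, smul_eq_mul, integral_const_mul] at this
    linarith
  have hm : ∫ v, ρ v ∂(gaussMeasure Q')
      ≤ 2 / β * (Real.log (gaussZ Q) - Real.log (gaussZ Q')) := by
    refine hm1.trans ?_
    rw [div_mul_eq_mul_div, le_div_iff₀ hβ]
    linarith
  -- lower bound for the unnormalized mixture
  have hlow : Real.exp (-(L a + g a)) * gaussZ Q' * Real.exp (-∫ v, ρ v ∂(gaussMeasure Q'))
      ≤ ∫ u, Real.exp (-(L u + g u)) := by
    -- As `H ≥ 0`, the surrogate dominates the linear part of `g`, so `L + g` is at most the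
    -- recentred quadratic plus `ρ`.
    have hpt : ∀ v, Real.exp (-(L a + g a)) * (Real.exp (-(1 / 2) * Q' v v) * Real.exp (-ρ v))
        ≤ Real.exp (-(L (a + v) + g (a + v))) := by
      intro v
      rw [← Real.exp_add, ← Real.exp_add, Real.exp_le_exp]
      have h1 := catLoss_add_le φ y a v
      have h2 := hquad v
      have h3 : g a + fderiv ℝ g a v ≤ quadApprox β g a (a + v) := by
        rw [quadApprox, add_sub_cancel_left]
        have := mul_nonneg (half_pos hβ).le (hHn v)
        linarith
      change g (a + v) ≤ g a + fderiv ℝ g a v + ρ v at h1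
      linarith
    have hρc : Continuous ρ := by rw [hρ]; fun_prop
    have hint : Integrable (fun v => Real.exp (-(1 / 2) * Q' v v) * Real.exp (-ρ v)) := by
      have hgi' := (hgi.comp_add_left a).const_mul (Real.exp (L a + g a))
      refine hgi'.mono' (by fun_prop) (Filter.Eventually.of_forall fun v => ?_)
      rw [Real.norm_of_nonneg (by positivity)]
      refine le_trans (le_of_eq ?_) (mul_le_mul_of_nonneg_left (hpt v) (Real.exp_pos _).le)
      rw [← mul_assoc (Real.exp (L a + g a)), ← Real.exp_add (L a + g a), add_neg_cancel,
        Real.exp_zero, one_mul]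
    have hint' : Integrable (fun v => Real.exp (-ρ v)) (gaussMeasure Q') := by
      rw [gaussMeasure, integrable_tilted_iff (integrable_gauss hc hQ')]
      exact hint
    have hJ := exp_integral_le hρi.neg hint'
    rw [gaussMeasure, integral_exp_tilted, ← gaussMeasure] at hJ
    replace hJ := (le_div_iff₀ hZ').1 hJ
    simp only [Pi.neg_apply, integral_neg, Pi.add_apply, Real.exp_add] at hJ
    rw [← integral_add_left_eq_self (fun u => Real.exp (-(L u + g u))) a]
    refine le_trans ?_ (integral_mono (hint.const_mul (Real.exp (-(L a + g a))))
      (hgi.comp_add_left a) hpt)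
    rw [integral_const_mul, mul_assoc, mul_comm (gaussZ Q')]
    exact mul_le_mul_of_nonneg_left hJ (Real.exp_pos _).le
  have hW : 0 < ∫ u, Real.exp (-L u) := integral_exp_pos hLi
  rw [integral_exp_tilted]
  simp only [Pi.add_apply, ← neg_add]
  have hpos : 0 < Real.exp (-(L a + g a)) * gaussZ Q' := by positivity
  have hlog := Real.log_le_log (by positivity) hlow
  rw [Real.log_mul hpos.ne' (Real.exp_pos _).ne', Real.log_exp, ← hnew] at hlog
  rw [Real.log_div (integral_exp_pos hgi).ne' hW.ne']
  linarith

end Round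

/-! ### Cumulative surrogate losses -/

section Cumulative

variable {E : Type*} [NormedAddCommGroup E] [InnerProductSpace ℝ E]

/-- The regularized sum of the quadratic approximations of `g_s` at `θ_{s+1}`. -/
def cumQuad (lam β : ℝ) (g : ℕ → E → ℝ) (θ : ℕ → E) (t : ℕ) (u : E) : ℝ :=
  ∑ s ∈ Finset.Icc 1 t, quadApprox β (g s) (θ (s + 1)) u + lam * ‖u‖ ^ 2

/-- The Hessian of `cumQuad`. -/
def cumHess (lam β : ℝ) (g : ℕ → E → ℝ) (θ : ℕ → E) (t : ℕ) : E →L[ℝ] E →L[ℝ] ℝ :=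
  (2 * lam) • innerForm E + ∑ s ∈ Finset.Icc 1 t, β • fderiv ℝ (fderiv ℝ (g s)) (θ (s + 1))

lemma cumQuad_succ (lam β : ℝ) (g : ℕ → E → ℝ) (θ : ℕ → E) (t : ℕ) (u : E) :
    cumQuad lam β g θ (t + 1) u
      = cumQuad lam β g θ t u + quadApprox β (g (t + 1)) (θ (t + 2)) u := by
  rw [cumQuad, cumQuad, Finset.sum_Icc_succ_top (by omega)]
  ring

lemma cumHess_succ (lam β : ℝ) (g : ℕ → E → ℝ) (θ : ℕ → E) (t : ℕ) :
    cumHess lam β g θ (t + 1)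
      = cumHess lam β g θ t + β • fderiv ℝ (fderiv ℝ (g (t + 1))) (θ (t + 2)) := by
  rw [cumHess, cumHess, Finset.sum_Icc_succ_top (by omega), ← add_assoc]

lemma cumHess_zero_apply (lam β : ℝ) (g : ℕ → E → ℝ) (θ : ℕ → E) (v : E) :
    cumHess lam β g θ 0 v v = 2 * lam * ‖v‖ ^ 2 := by
  rw [← real_inner_self_eq_norm_sq]
  simp [cumHess, innerForm_apply]

lemma cumQuad_congr (lam β : ℝ) (g : ℕ → E → ℝ) {θ θ' : ℕ → E} {t : ℕ}
    (h : ∀ s, s ≤ t + 1 → θ s = θ' s) : cumQuad lam β g θ t = cumQuad lam β g θ' t := by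
  funext u
  rw [cumQuad, cumQuad]
  congr 1
  refine Finset.sum_congr rfl fun s hs => ?_
  rw [h (s + 1) (by have := (Finset.mem_Icc.1 hs).2; omega)]

variable {K : ℕ} [NeZero K] {lam β R : ℝ} {φ : ℕ → Fin K → E →L[ℝ] ℝ} {y : ℕ → Fin K} {θ : ℕ → E}
  {g : ℕ → E → ℝ} {n : ℕ}

lemma isQuadratic_cumQuad (hg : ∀ t, g t = catLoss (φ t) (y t)) (t : ℕ) :
    IsQuadratic (cumQuad lam β g θ t) (cumHess lam β g θ t) := by
  induction t with
  | zero =>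
    have h1 : cumQuad lam β g θ 0 = fun u => lam * ‖u‖ ^ 2 := by funext u; simp [cumQuad]
    have h2 : cumHess lam β g θ 0 = (2 * lam) • innerForm E := by simp [cumHess]
    rw [h1, h2]
    exact isQuadratic_mul_sq_norm lam
  | succ t ih =>
    rw [funext (cumQuad_succ lam β g θ t), cumHess_succ]
    refine ih.add (isQuadratic_quadApprox _ _ _ fun v w => ?_)
    rw [hg]
    exact fderiv_fderiv_catLoss_symm _ _ _ v w

lemma cumHess_symm (hg : ∀ t, g t = catLoss (φ t) (y t)) (t : ℕ) (v w : E) :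
    cumHess lam β g θ t v w = cumHess lam β g θ t w v := by
  induction t with
  | zero => simp [cumHess, innerForm_apply, real_inner_comm]
  | succ t ih =>
    rw [cumHess_succ]
    simp only [add_apply, smul_apply, ih, hg, fderiv_fderiv_catLoss_symm _ _ _ v w]

lemma le_cumHess (hg : ∀ t, g t = catLoss (φ t) (y t)) (hβ : 0 ≤ β) (t : ℕ) (v : E) :
    2 * lam * ‖v‖ ^ 2 ≤ cumHess lam β g θ t v v := by
  induction t with
  | zero => rw [cumHess_zero_apply]
  | succ t ih =>
    rw [cumHess_succ]
    simp only [add_apply, smul_apply, smul_eq_mul, hg]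
    have := mul_nonneg hβ
      (fderiv_fderiv_catLoss_nonneg (φ (t + 1)) (y (t + 1)) (θ (t + 2)) v)
    linarith

lemma cumHess_le (hg : ∀ t, g t = catLoss (φ t) (y t)) (hβ : 0 ≤ β)
    (hR : ∀ t, 1 ≤ t → t ≤ n → ∀ j, ‖φ t j‖ ≤ R) {t : ℕ} (ht : t ≤ n) (v : E) :
    cumHess lam β g θ t v v ≤ (2 * lam + t * β * R ^ 2) * ‖v‖ ^ 2 := by
  induction t with
  | zero => rw [cumHess_zero_apply]; simp
  | succ t ih =>
    have h1 := ih (by omega)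
    have h2 := mul_le_mul_of_nonneg_left (fderiv_fderiv_catLoss_le (hR (t + 1) (by omega) ht)
      (y (t + 1)) (θ (t + 2)) v) hβ
    rw [cumHess_succ]
    simp only [add_apply, smul_apply, smul_eq_mul, hg]
    push_cast
    linarith

/-- Changing the sequence at index `t + 2` leaves `cumQuad` at time `t` intact, since it reads only
the indices up to `t + 1`; estimators can thus be appended one at a time. -/
lemma exists_minimizer [FiniteDimensional ℝ E] (hg : ∀ t, g t = catLoss (φ t) (y t))
    (hβ : 0 ≤ β) (hlam : 0 < lam) (θ : ℕ → E) (t : ℕ) :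
    ∃ θ' : ℕ → E, (∀ s, s ≤ t + 1 → θ' s = θ s) ∧
      ∀ u, cumQuad lam β g θ' t (θ' (t + 2)) + g (t + 1) (θ' (t + 2))
        ≤ cumQuad lam β g θ' t u + g (t + 1) u := by
  obtain ⟨a, ha⟩ := (isQuadratic_cumQuad (lam := lam) (β := β) (θ := θ) hg t).exists_isMinOn_add
    (mul_pos two_pos hlam) (le_cumHess hg hβ t) (g := g (t + 1))
    (by rw [hg]; exact continuous_catLoss _ _) (by rw [hg]; exact catLoss_nonneg _ _)
  have h : ∀ s, s ≤ t + 1 → Function.update θ (t + 2) a s = θ s := fun s hs =>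
    Function.update_of_ne (by omega) _ _
  refine ⟨Function.update θ (t + 2) a, h, fun u => ?_⟩
  rw [cumQuad_congr lam β g h, Function.update_self]
  exact ha u

lemma exists_estimators [FiniteDimensional ℝ E] (hg : ∀ t, g t = catLoss (φ t) (y t))
    (hβ : 0 ≤ β) (hlam : 0 < lam) (n : ℕ) :
    ∃ θ : ℕ → E, θ 1 = 0 ∧ ∀ s, s < n → ∀ u,
      cumQuad lam β g θ s (θ (s + 2)) + g (s + 1) (θ (s + 2))
        ≤ cumQuad lam β g θ s u + g (s + 1) u := by
  induction n with
  | zero => exact ⟨0, rfl, fun s hs => absurd hs (by omega)⟩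
  | succ n ih =>
    obtain ⟨θ, h1, h2⟩ := ih
    obtain ⟨θ', h3, h4⟩ := exists_minimizer hg hβ hlam θ n
    refine ⟨θ', by rw [h3 1 (by omega), h1], fun s hs u => ?_⟩
    rcases Nat.lt_succ_iff_lt_or_eq.1 hs with hs | rfl
    · rw [h3 (s + 2) (by omega), cumQuad_congr lam β g fun r hr => h3 r (by omega)]
      exact h2 s hs u
    · exact h4 u

variable [FiniteDimensional ℝ E] [MeasurableSpace E] [BorelSpace E]

lemma sum_mix_loss_le (hg : ∀ t, g t = catLoss (φ t) (y t)) (hβ : 0 < β) (hlam : 0 < lam)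
    (hR : ∀ t, 1 ≤ t → t ≤ n → ∀ j, ‖φ t j‖ ≤ R) (hRlam : 4 * R ^ 2 ≤ 2 * lam)
    (hmin : ∀ s, s < n → ∀ u, cumQuad lam β g θ s (θ (s + 2)) + g (s + 1) (θ (s + 2))
        ≤ cumQuad lam β g θ s u + g (s + 1) u) {t : ℕ} (ht : t ≤ n) :
    ∑ s ∈ Finset.Icc 1 t, -Real.log (∫ u, Real.exp (-g s u)
        ∂((volume : Measure E).tilted fun u => -cumQuad lam β g θ (s - 1) u)) ≤
      Real.log (∫ u, Real.exp (-cumQuad lam β g θ 0 u))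
        - Real.log (∫ u, Real.exp (-cumQuad lam β g θ t u))
        + 2 / β * (Real.log (gaussZ (cumHess lam β g θ 0))
          - Real.log (gaussZ (cumHess lam β g θ t))) := by
  induction t with
  | zero => simp
  | succ t ih =>
    have h1 := ih (by omega)
    have hm := hmin t ht
    rw [hg (t + 1)] at hm
    have h2 := neg_log_integral_tilted_le (isQuadratic_cumQuad hg t) (mul_pos two_pos hlam)
      (le_cumHess hg hβ.le t) (cumHess_symm hg t) (hR (t + 1) (by omega) ht) hRlam (y (t + 1))
      hβ hm
    rw [Finset.sum_Icc_succ_top (by omega), funext (cumQuad_succ lam β g θ t), cumHess_succ]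
    rw [← hg (t + 1)] at h2
    simp only [add_tsub_cancel_right]
    linarith

/-- The regret bound in terms of `lam`, `β` and the dimension. -/
lemma sum_mix_loss_sub_le (hg : ∀ t, g t = catLoss (φ t) (y t)) (hβ : 0 < β) (hlam : 0 < lam)
    (hR : ∀ t, 1 ≤ t → t ≤ n → ∀ j, ‖φ t j‖ ≤ R) (hRlam : 4 * R ^ 2 ≤ 2 * lam)
    (hmin : ∀ s, s < n → ∀ u, cumQuad lam β g θ s (θ (s + 2)) + g (s + 1) (θ (s + 2))
        ≤ cumQuad lam β g θ s u + g (s + 1) u) (hn : 1 ≤ n) {u : E}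
    (hu : ∀ t, 1 ≤ t → t ≤ n → quadApprox β (g t) (θ (t + 1)) u ≤ g t u) :
    ∑ s ∈ Finset.Icc 1 n, -Real.log (∫ v, Real.exp (-g s v)
        ∂((volume : Measure E).tilted fun v => -cumQuad lam β g θ (s - 1) v))
      - ∑ s ∈ Finset.Icc 1 n, g s u ≤
      lam * ‖u‖ ^ 2 + (1 + 2 / β) * (Module.finrank ℝ E / 2 *
        Real.log ((2 * lam + n * β * R ^ 2) / (2 * lam))) := by
  have hc : 0 < 2 * lam := mul_pos two_pos hlam
  have h1 := sum_mix_loss_le hg hβ hlam hR hRlam hmin le_rfl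
  obtain ⟨k, rfl⟩ : ∃ k, n = k + 1 := ⟨n - 1, by omega⟩
  have hquad := (isQuadratic_cumQuad (lam := lam) (β := β) (θ := θ) hg k).add_quadApprox_eq
    (g := g (k + 1)) (by rw [hg]; exact (hasFDerivAt_catLoss _ _ _).differentiableAt)
    (hmin k (by omega)) β
  simp only [← cumQuad_succ, ← cumHess_succ] at hquad
  set a := θ (k + 2)
  have ha := hquad 0
  simp only [add_zero, map_zero, mul_zero] at ha
  rw [← ha] at hquad
  have h2 := integral_exp_neg_of_eq hquad
  have h3 : cumQuad lam β g θ (k + 1) a ≤ cumQuad lam β g θ (k + 1) u := by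
    have h := hquad (u - a)
    rw [add_sub_cancel] at h
    have h' := le_cumHess (lam := lam) (θ := θ) hg hβ.le (k + 1) (u - a)
    have : 0 ≤ 2 * lam * ‖u - a‖ ^ 2 := by positivity
    linarith
  have h4 : cumQuad lam β g θ (k + 1) u ≤ ∑ s ∈ Finset.Icc 1 (k + 1), g s u + lam * ‖u‖ ^ 2 := by
    rw [cumQuad]
    gcongr with s hs
    exact hu s (Finset.mem_Icc.1 hs).1 (Finset.mem_Icc.1 hs).2
  have h5 : ∫ v, Real.exp (-cumQuad lam β g θ 0 v) = gaussZ (cumHess lam β g θ 0) := by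
    rw [gaussZ]
    congr 1; funext v
    rw [cumHess_zero_apply, cumQuad]
    congr 1
    simp
    ring
  have h6 := log_gaussZ_sub_le hc (cumHess_zero_apply lam β g θ)
    (le_cumHess (lam := lam) (θ := θ) hg hβ.le (k + 1)) (cumHess_le hg hβ.le hR le_rfl)
    (le_add_of_nonneg_right (by positivity))
  have hZ := gaussZ_pos hc (le_cumHess (lam := lam) (θ := θ) hg hβ.le (k + 1))
  rw [h5, h2, Real.log_mul (Real.exp_pos _).ne' hZ.ne', Real.log_exp] at h1
  -- The 1 comes from the Gaussian volumes in the first and last potentials, `2 / β` from the Jensen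
  -- losses of the rounds.
  have h7 := mul_le_mul_of_nonneg_left h6 (show 0 ≤ 1 + 2 / β by positivity)
  linarith

end Cumulative

/-! ### Multi-class logistic regression -/

section Logistic

variable {d' K : ℕ}

/-- The linear form `θ ↦ ⟨θ_j, x⟩` of the block `j` of the parameter. -/
def blockForm (x : EuclideanSpace ℝ (Fin d')) (j : Fin K) :
    EuclideanSpace ℝ (Fin K × Fin d') →L[ℝ] ℝ :=
  innerSL ℝ (WithLp.toLp 2 fun p => featureMap x p j)

lemma blockForm_apply (x : EuclideanSpace ℝ (Fin d')) (j : Fin K)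
    (θ : EuclideanSpace ℝ (Fin K × Fin d')) : blockForm x j θ = linearPredictor θ x j := by
  simp [blockForm, linearPredictor, Matrix.vecMul, dotProduct, PiLp.inner_apply]

lemma norm_blockForm (x : EuclideanSpace ℝ (Fin d')) (j : Fin K) : ‖blockForm x j‖ = ‖x‖ := by
  rw [blockForm, innerSL_apply_norm, EuclideanSpace.norm_eq, EuclideanSpace.norm_eq,
    Fintype.sum_prod_type, Finset.sum_eq_single j]
  · simp [featureMap]
  · intro i _ hij
    simp [featureMap, hij]
  · simp

lemma paramLoss_eq_catLoss (x : EuclideanSpace ℝ (Fin d')) (y : Fin K) :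
    paramLoss logisticLoss linearPredictor x y = catLoss (blockForm x) y := by
  funext θ
  exact congrArg (logisticLoss · y) (funext fun j => (blockForm_apply x j θ).symm)

lemma cumSurrogate_eq_cumQuad (lam β : ℝ) (x : ℕ → EuclideanSpace ℝ (Fin d')) (y : ℕ → Fin K)
    (θ : ℕ → EuclideanSpace ℝ (Fin K × Fin d')) (t : ℕ) :
    cumSurrogate logisticLoss linearPredictor lam β x y θ t
      = cumQuad lam β (fun s => paramLoss logisticLoss linearPredictor (x s) (y s)) θ t := rfl

/-- The logarithms of the mean class probabilities satisfy the mixability inequality. -/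
lemma exists_mix_prediction [NeZero K] {Ω : Type*} [MeasurableSpace Ω] {μ : Measure Ω}
    [IsProbabilityMeasure μ] (z : Ω → Fin K → ℝ)
    (hz : ∀ y, AEStronglyMeasurable (fun ω => Real.exp (-logisticLoss (z ω) y)) μ) :
    ∃ w : Fin K → ℝ, ∀ y,
      logisticLoss w y = -Real.log (∫ ω, Real.exp (-logisticLoss (z ω) y) ∂μ) := by
  have hi : ∀ y, Integrable (fun ω => Real.exp (-logisticLoss (z ω) y)) μ := fun y => by
    refine (integrable_const (1 : ℝ)).mono' (hz y) (Filter.Eventually.of_forall fun ω => ?_)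
    rw [Real.norm_of_nonneg (Real.exp_pos _).le, exp_neg_logisticLoss]
    exact softmax_le_one _ _
  have hpos : ∀ y, 0 < ∫ ω, Real.exp (-logisticLoss (z ω) y) ∂μ := fun y => integral_exp_pos (hi y)
  -- The mean class probabilities sum to 1, so the log-partition function of their logarithms
  -- vanishes and equality holds.
  refine ⟨fun y => Real.log (∫ ω, Real.exp (-logisticLoss (z ω) y) ∂μ), fun y => ?_⟩
  rw [logisticLoss_eq]
  simp only [Real.exp_log (hpos _)]
  rw [← integral_finsetSum _ fun j _ => hi j]
  simp only [exp_neg_logisticLoss, sum_softmax]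
  simp

lemma exists_isRun [NeZero K] {lam β : ℝ} (hlam : 0 < lam) (hβ : 0 < β) (n : ℕ)
    (x : ℕ → EuclideanSpace ℝ (Fin d')) (y : ℕ → Fin K) :
    ∃ (θ : ℕ → EuclideanSpace ℝ (Fin K × Fin d')) (yhat : ℕ → Fin K → ℝ),
      IsRun logisticLoss linearPredictor lam β 1 n x y θ yhat := by
  have hg := fun t => paramLoss_eq_catLoss (x t) (y t)
  obtain ⟨θ, h1, h2⟩ := exists_estimators hg hβ.le hlam n
  have hpred : ∀ t, ∃ w : Fin K → ℝ, ∀ y', logisticLoss w y' = -(1 / 1) * Real.log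
      (∫ u, Real.exp (-1 * paramLoss logisticLoss linearPredictor (x t) y' u)
        ∂(aggDist logisticLoss linearPredictor lam β 1 x y θ (t - 1))) := by
    intro t
    have : IsProbabilityMeasure (aggDist logisticLoss linearPredictor lam β 1 x y θ (t - 1)) := by
      refine isProbabilityMeasure_tilted ?_
      simp only [cumSurrogate_eq_cumQuad, neg_one_mul]
      exact (isQuadratic_cumQuad hg (t - 1)).integrable_exp_neg (mul_pos two_pos hlam)
        (le_cumHess hg hβ.le (t - 1)) (cumHess_symm hg (t - 1))
    simp only [div_one, neg_one_mul]
    refine exists_mix_prediction (fun u => linearPredictor u (x t)) fun y' => ?_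
    have hc : Continuous (paramLoss logisticLoss linearPredictor (x t) y') := by
      rw [paramLoss_eq_catLoss]; exact continuous_catLoss _ _
    exact hc.neg.rexp.aestronglyMeasurable
  choose yhat hyhat using hpred
  refine ⟨θ, yhat, h1, fun t ht htn => ?_, fun t _ _ y' => (hyhat t y').le⟩
  obtain ⟨s, rfl⟩ : ∃ s, t = s + 2 := ⟨t - 2, by omega⟩
  intro u _
  have h := h2 s (by omega) u
  simp only [cumQuad] at h
  simp only [Set.mem_ofPred_eq, surrogate, Nat.add_sub_cancel, show s + 2 - 1 = s + 1 from rfl]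
  linarith

lemma regret_le [NeZero K] {lam b R : ℝ} {n : ℕ} (hlam : 0 < lam) (hb : 0 ≤ b) (hn : 1 ≤ n)
    {x : ℕ → EuclideanSpace ℝ (Fin d')} {y : ℕ → Fin K}
    (hx : ∀ t, 1 ≤ t → t ≤ n → ‖x t‖ ≤ R) (hRlam : 4 * R ^ 2 ≤ 2 * lam)
    {θ : ℕ → EuclideanSpace ℝ (Fin K × Fin d')} {yhat : ℕ → Fin K → ℝ}
    (hrun : IsRun logisticLoss linearPredictor lam (Real.log K / 2 + b + 1)⁻¹ 1 n x y θ yhat)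
    {u : EuclideanSpace ℝ (Fin K × Fin d')} (hu : R * ‖u‖ ≤ b) :
    regret logisticLoss linearPredictor x y yhat n u ≤
      lam * ‖u‖ ^ 2 + (Real.log K + 2 * b + 3) * ((K * d' : ℕ) / 2 *
        Real.log ((2 * lam + n * (Real.log K / 2 + b + 1)⁻¹ * R ^ 2) / (2 * lam))) := by
  have hK1 : (1 : ℝ) ≤ K := by exact_mod_cast Nat.one_le_iff_ne_zero.2 (NeZero.ne K)
  have hlog := Real.log_nonneg hK1
  have hβ : 0 < (Real.log K / 2 + b + 1)⁻¹ := by positivity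
  have hβ' : 1 + 2 / (Real.log K / 2 + b + 1)⁻¹ = Real.log K + 2 * b + 3 := by
    rw [div_inv_eq_mul]; ring
  rw [← hβ']
  set β := (Real.log K / 2 + b + 1)⁻¹ with hβdef
  have hg := fun t => paramLoss_eq_catLoss (x t) (y t)
  obtain ⟨k, rfl⟩ : ∃ k, n = k + 1 := ⟨n - 1, by omega⟩
  -- A run of `n` rounds does not prescribe `θ_{n+1}`, yet the last surrogate is centred there. It
  -- is supplied here; the predictions depend only on `θ_1, …, θ_n`.
  obtain ⟨θ', hθ', hmin'⟩ := exists_minimizer hg hβ.le hlam θ k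
  have hmin : ∀ s, s < k + 1 → ∀ v,
      cumQuad lam β (fun s => paramLoss logisticLoss linearPredictor (x s) (y s)) θ' s (θ' (s + 2))
        + paramLoss logisticLoss linearPredictor (x (s + 1)) (y (s + 1)) (θ' (s + 2)) ≤
      cumQuad lam β (fun s => paramLoss logisticLoss linearPredictor (x s) (y s)) θ' s v
        + paramLoss logisticLoss linearPredictor (x (s + 1)) (y (s + 1)) v := by
    intro s hs v
    rcases Nat.lt_succ_iff_lt_or_eq.1 hs with hs | rfl
    · rw [hθ' (s + 2) (by omega), cumQuad_congr lam β _ fun r hr => hθ' r (by omega)]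
      have h := hrun.estimator (s + 2) (by omega) (by omega) (Set.mem_univ v)
      simp only [Set.mem_ofPred_eq, surrogate, Nat.add_sub_cancel,
        show s + 2 - 1 = s + 1 from rfl] at h
      simp only [cumQuad]
      linarith
    · exact hmin' v
  have hR : ∀ t, 1 ≤ t → t ≤ k + 1 → ∀ j : Fin K, ‖blockForm (x t) j‖ ≤ R := fun t h1 h2 j => by
    rw [norm_blockForm]; exact hx t h1 h2
  have hmain := sum_mix_loss_sub_le hg hβ hlam hR hRlam hmin hn (u := u) fun t h1 h2 => by
    rw [hg]
    refine quadApprox_catLoss_le hb _ _ _ _ fun j => ?_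
    exact ((blockForm (x t) j).le_of_opNorm_le (hR t h1 h2 j) u).trans hu
  have hfin : Module.finrank ℝ (EuclideanSpace ℝ (Fin K × Fin d')) = K * d' := by simp
  rw [hfin] at hmain
  refine le_trans (sub_le_sub_right (Finset.sum_le_sum fun t ht => ?_) _) hmain
  have ht' := Finset.mem_Icc.1 ht
  have h := hrun.prediction t ht'.1 ht'.2 (y t)
  simp only [aggDist, cumSurrogate_eq_cumQuad, neg_one_mul, div_one] at h
  rw [cumQuad_congr lam β _ fun r hr => hθ' r (by omega)]
  exact h

lemma regret_eq_zero_of_one (n : ℕ) (x : ℕ → EuclideanSpace ℝ (Fin d')) (y : ℕ → Fin 1)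
    (yhat : ℕ → Fin 1 → ℝ) (u : EuclideanSpace ℝ (Fin 1 × Fin d')) :
    regret logisticLoss linearPredictor x y yhat n u = 0 := by
  have h : ∀ (z : Fin 1 → ℝ) (i : Fin 1), logisticLoss z i = 0 := by
    intro z i
    rw [logisticLoss_eq, Subsingleton.elim i 0]
    simp
  simp [regret, paramLoss, h]

end Logistic

end GAF

end

/-! ### Choice of the constants -/

theorem mainTheorem2 :
    ∃ C c : ℝ, 0 < C ∧ 0 ≤ c ∧
      ∀ (d' n K : ℕ), 1 ≤ d' → 1 ≤ n → 1 ≤ K →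
      ∀ (R B : ℝ), 0 < R → 0 < B →
      ∀ (x : ℕ → EuclideanSpace ℝ (Fin d')) (y : ℕ → Fin K),
        (∀ t, 1 ≤ t → t ≤ n → ‖x t‖ ≤ R) →
        (∃ (θ : ℕ → EuclideanSpace ℝ (Fin K × Fin d')) (yhat : ℕ → Fin K → ℝ),
          GAF.IsRun GAF.logisticLoss GAF.linearPredictor
            (32 * d' * K * R ^ 2) ((Real.log K / 2 + B * R + 1)⁻¹) 1 n x y θ yhat) ∧
        ∀ (θ : ℕ → EuclideanSpace ℝ (Fin K × Fin d')) (yhat : ℕ → Fin K → ℝ),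
          GAF.IsRun GAF.logisticLoss GAF.linearPredictor
            (32 * d' * K * R ^ 2) ((Real.log K / 2 + B * R + 1)⁻¹) 1 n x y θ yhat →
          ∀ u : EuclideanSpace ℝ (Fin K × Fin d'), ‖u‖ ≤ B →
            GAF.regret GAF.logisticLoss GAF.linearPredictor x y yhat n u ≤
              C * (d' * K * B ^ 2 * R ^ 2
                + d' * K * (Real.log K + B * R)
                  * Real.log (1 + n / (d' * K * (Real.log K + B * R)))) + c := by
  -- The 32 comes from `lam ‖u‖²`; the logarithmic term needs only 4.
  refine ⟨32, 0, by norm_num, le_rfl, ?_⟩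
  intro d' n K hd hn hK R B hR hB x y hx
  have : NeZero K := ⟨by omega⟩
  have hdr : (1 : ℝ) ≤ d' := by exact_mod_cast hd
  have hKr : (1 : ℝ) ≤ K := by exact_mod_cast hK
  have hnr : (0 : ℝ) ≤ n := Nat.cast_nonneg n
  have hlog := Real.log_nonneg hKr
  have hBR : 0 < B * R := mul_pos hB hR
  have hD1 : (1 : ℝ) ≤ d' * K := one_le_mul_of_one_le_of_one_le hdr hKr
  have hlam : 0 < 32 * d' * K * R ^ 2 := by positivity
  refine ⟨GAF.exists_isRun hlam (by positivity) n x y, fun θ yhat hrun u hu => ?_⟩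
  -- For `K = 1`, `log K + B R` may be too small to absorb additive constants, but the loss vanishes
  -- identically.
  rcases hK.eq_or_lt with rfl | hK2
  · rw [GAF.regret_eq_zero_of_one]
    have h : 0 ≤ Real.log (1 + n / (d' * (1 : ℕ) * (Real.log (1 : ℕ) + B * R))) :=
      Real.log_nonneg (le_add_of_nonneg_right (by positivity))
    positivity
  have hlog2 : 1 / 2 ≤ Real.log K :=
    (by linarith [Real.log_two_gt_d9] : 1 / 2 ≤ Real.log 2).trans
      (Real.log_le_log two_pos (by exact_mod_cast hK2))
  have hb : R * ‖u‖ ≤ B * R := by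
    rw [mul_comm]; exact mul_le_mul_of_nonneg_right hu hR.le
  have hRlam : 4 * R ^ 2 ≤ 2 * (32 * d' * K * R ^ 2) := by
    nlinarith [mul_le_mul_of_nonneg_right hD1 (sq_nonneg R), sq_nonneg R]
  have hmain := GAF.regret_le hlam hBR.le hn hx hRlam hrun hb
  set m := Real.log K + B * R with hm
  have hm0 : 0 < m := by positivity
  -- As `lam` is proportional to `d' K R²`, the radius cancels and `d' K` appears in the
  -- denominator.
  have hratio : (2 * (32 * d' * K * R ^ 2) + n * (Real.log K / 2 + B * R + 1)⁻¹ * R ^ 2)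
      / (2 * (32 * d' * K * R ^ 2)) ≤ 1 + n / (d' * K * m) := by
    have h1 : (2 * (32 * d' * K * R ^ 2) + n * (Real.log K / 2 + B * R + 1)⁻¹ * R ^ 2)
        / (2 * (32 * d' * K * R ^ 2))
        = 1 + n / (d' * K * (64 * (Real.log K / 2 + B * R + 1))) := by
      have : Real.log K / 2 + B * R + 1 ≠ 0 := by positivity
      field_simp
      ring
    rw [h1]
    gcongr
    linarith
  have hL := Real.log_le_log (by positivity) hratio
  set Lg := Real.log (1 + n / (d' * K * m)) with hLg
  have hLg0 : 0 ≤ Lg := Real.log_nonneg (le_add_of_nonneg_right (by positivity))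
  have hu2 : ‖u‖ ^ 2 ≤ B ^ 2 := by gcongr
  calc GAF.regret GAF.logisticLoss GAF.linearPredictor x y yhat n u
      ≤ 32 * d' * K * R ^ 2 * ‖u‖ ^ 2 + (Real.log K + 2 * (B * R) + 3) * ((K * d' : ℕ) / 2 *
        Real.log ((2 * (32 * d' * K * R ^ 2) + n * (Real.log K / 2 + B * R + 1)⁻¹ * R ^ 2)
          / (2 * (32 * d' * K * R ^ 2)))) := hmain
    _ ≤ 32 * d' * K * R ^ 2 * B ^ 2 + (Real.log K + 2 * (B * R) + 3) * ((K * d' : ℕ) / 2 * Lg) := by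
        gcongr
    -- For `K ≥ 2`, `log K ≥ 1/2` gives `3 ≤ 7 log K`, which absorbs the constant 3.
    _ ≤ 32 * d' * K * R ^ 2 * B ^ 2 + 8 * m * ((K * d' : ℕ) / 2 * Lg) := by
        gcongr
        linarith
    _ ≤ 32 * (d' * K * B ^ 2 * R ^ 2 + d' * K * m * Lg) + 0 := by
        have : 0 ≤ d' * K * m * Lg := by positivity
        push_cast
        linarith
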